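/- All complex spaces are Hausdorff, and *variety* means normal irreducible reduced complex (analytic) space. A prime divisor is an irreducible closed analytic subset of pure codimension one. An orbifold pair $(Y,\Delta)$ is a variety $Y$ with a divisor $\Delta=\sum_i\left(1-\frac1{m_i}\right)\Delta_i$, where $(\Delta_i)$ is a locally finite family of distinct prime divisors and $m_i\in\{2,3,\dots\}\cup\{\infty\}$; put $\lceil\Delta\rceil=\bigcup_i\Delta_i$, $m_Y(\Delta_i)=m_i$, and $m_Y(D)=1$ for every other prime divisor $D$ of $Y$. Let $f\colon X\to Y$ be holomorphic, $D$ a prime divisor of $Y$ and $E$ a component of $f^{-1}(D)$ of codimension one. The multiplicity $t_{E,D}$ of $E$ in $f^*D$ is the smallest order of vanishing along $E$, at general points of $E$, of the functions $g\circ f$, where $g$ is a holomorphic germ on $Y$ vanishing on $D$ (if $D$ is Cartier, this is the order of $g\circ f$ for a local equation $g$ of $D$). The map $f$ is an orbifold morphism $(X,\Delta_X)\to(Y,\Delta_Y)$ if $f(X)\not\subset\lceil\Delta_Y\rceil$ and $t_{E,D}\cdot m_X(E)\ge m_Y(D)$ for all such $D$ and $E$. A variety $X$ is identified with the orbifold pair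 $(X,0)$, and $\mathrm{Hol}(X,(Y,\Delta))$ denotes the set of orbifold morphisms $X\to(Y,\Delta)$. **Theorem.** Let $X$ be a variety and $(Y,\Delta)$ an orbifold pair with $\Delta=\sum_i\left(1-\frac1{m_i}\right)\Delta_i$. Let $\mathcal F\subset\mathrm{Hol}(X,(Y,\Delta))$ be a subset which is locally closed in the space $\mathrm{Hol}(X,Y)$ of holomorphic maps (with the compact-open topology), and which, with its subspace topology, carries a structure of variety (in particular normal) for which the evaluation map $$ev\colon X\times\mathcal F\to Y,\qquad (x,f)\mapsto f(x)$$ is holomorphic. Then $ev\colon X\times\mathcal F\to(Y,\Delta)$ is an orbifold morphism. In particular, for every $i$, every component of $ev^*\Delta_i$ has multiplicity at least $m_i$. -/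

import Mathlib

open Set Filter Topology

/-- A *local model* on the open set `U`, for a notion `H u x` of "the function `u` is holomorphic
at `x`": the map `φ` identifies `U` with the common zero set of finitely many holomorphic functions
on an open subset `Ω` of `ℂⁿ`, and the holomorphic germs on `U` are exactly the restrictions
of the germs of holomorphic functions of `n` variables. -/
structure IsLocalModel {X : Type*} [TopologicalSpace X] (H : (X → ℂ) → X → Prop)
    (n : ℕ) (U : Set X) (φ : X → (Fin n → ℂ)) (Ω : Set (Fin n → ℂ)) : Prop where
  isOpen_source : IsOpen U
  isOpen_ambient : IsOpen Ω
  isEmbedding : IsEmbedding (U.domRestrict φ)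
  image_analytic : ∃ S : Set ((Fin n → ℂ) → ℂ), S.Finite ∧ (∀ g ∈ S, AnalyticOnNhd ℂ g Ω) ∧
    φ '' U = {z | z ∈ Ω ∧ ∀ g ∈ S, g z = 0}
  hol_iff : ∀ x ∈ U, ∀ u : X → ℂ, H u x ↔
    ∃ G : (Fin n → ℂ) → ℂ, AnalyticAt ℂ G (φ x) ∧ u =ᶠ[𝓝 x] fun y => G (φ y)

/-- A reduced complex (analytic) space, given by its sheaf of holomorphic functions:
`HolAt u x` says that the germ at `x` of the function `u` is holomorphic. -/
class ComplexSpace (X : Type*) [TopologicalSpace X] where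
  HolAt : (X → ℂ) → X → Prop
  exists_localModel : ∀ x : X, ∃ (n : ℕ) (U : Set X) (φ : X → (Fin n → ℂ)) (Ω : Set (Fin n → ℂ)),
    x ∈ U ∧ IsLocalModel HolAt n U φ Ω

namespace ComplexSpace

section Basic

variable {X : Type*} [TopologicalSpace X] [ComplexSpace X]

theorem holAt_const (c : ℂ) (x : X) : HolAt (fun _ => c) x := by
  obtain ⟨n, U, φ, Ω, hx, hm⟩ := exists_localModel x
  exact (hm.hol_iff x hx _).2 ⟨fun _ => c, analyticAt_const, Eventually.of_forall fun _ => rfl⟩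

theorem HolAt.add {u v : X → ℂ} {x : X} (hu : HolAt u x) (hv : HolAt v x) :
    HolAt (fun y => u y + v y) x := by
  obtain ⟨n, U, φ, Ω, hx, hm⟩ := exists_localModel x
  obtain ⟨G, hG, e⟩ := (hm.hol_iff x hx u).1 hu
  obtain ⟨G', hG', e'⟩ := (hm.hol_iff x hx v).1 hv
  refine (hm.hol_iff x hx _).2 ⟨fun z => G z + G' z, hG.add hG', ?_⟩
  filter_upwards [e, e'] with y h h'
  rw [h, h']

theorem HolAt.mul {u v : X → ℂ} {x : X} (hu : HolAt u x) (hv : HolAt v x) :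
    HolAt (fun y => u y * v y) x := by
  obtain ⟨n, U, φ, Ω, hx, hm⟩ := exists_localModel x
  obtain ⟨G, hG, e⟩ := (hm.hol_iff x hx u).1 hu
  obtain ⟨G', hG', e'⟩ := (hm.hol_iff x hx v).1 hv
  refine (hm.hol_iff x hx _).2 ⟨fun z => G z * G' z, hG.mul hG', ?_⟩
  filter_upwards [e, e'] with y h h'
  rw [h, h']

/-- The local ring of germs of holomorphic functions at `x`. -/
def holGerms (x : X) : Subring (Germ (𝓝 x) ℂ) where
  carrier := {a | ∃ u : X → ℂ, HolAt u x ∧ a = (u : Germ (𝓝 x) ℂ)}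
  mul_mem' := by
    rintro _ _ ⟨u, hu, rfl⟩ ⟨v, hv, rfl⟩
    exact ⟨_, hu.mul hv, rfl⟩
  one_mem' := ⟨_, holAt_const 1 x, rfl⟩
  add_mem' := by
    rintro _ _ ⟨u, hu, rfl⟩ ⟨v, hv, rfl⟩
    exact ⟨_, hu.add hv, rfl⟩
  zero_mem' := ⟨_, holAt_const 0 x, rfl⟩
  neg_mem' := by
    rintro _ ⟨u, hu, rfl⟩
    refine ⟨fun y => (-1) * u y, (holAt_const (-1) x).mul hu, ?_⟩
    rw [← Germ.coe_neg]
    congr 1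
    funext y
    simp

/-- `φ` is a system of local coordinates on `U`: a biholomorphic map from `U` onto an open subset
of `ℂⁿ`. -/
def IsCoordinates (n : ℕ) (U : Set X) (φ : X → (Fin n → ℂ)) : Prop :=
  IsLocalModel (HolAt (X := X)) n U φ (φ '' U)

variable (X) in
/-- The set of regular (smooth) points of `X`. -/
def regularLocus : Set X :=
  {x | ∃ (n : ℕ) (U : Set X) (φ : X → (Fin n → ℂ)), x ∈ U ∧ IsCoordinates n U φ}

/-- Closed analytic subsets: locally (near every point of `X`) the common zero set of finitely many
holomorphic functions. -/
def IsAnalyticSubset (A : Set X) : Prop :=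
  ∀ x : X, ∃ (U : Set X) (S : Set (X → ℂ)), IsOpen U ∧ x ∈ U ∧ S.Finite ∧
    (∀ u ∈ S, ∀ y ∈ U, HolAt u y) ∧ A ∩ U = {y | y ∈ U ∧ ∀ u ∈ S, u y = 0}

/-- The points of `A` which are regular points of `X` and at which `A` is a smooth
hypersurface, given by the vanishing of the first coordinate in suitable local coordinates. -/
def hypersurfaceLocus (A : Set X) : Set X :=
  {x | x ∈ A ∧ ∃ (n : ℕ) (U : Set X) (φ : X → (Fin (n + 1) → ℂ)), x ∈ U ∧ IsCoordinates (n + 1) U φ ∧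
    ∀ y ∈ U, y ∈ A ↔ φ y 0 = 0}

/-- Irreducible (prime Weil) divisors of a normal complex space: the analytic subsets of
pure codimension one whose regular part (outside the singular locus of the space, which has
codimension at least two) is connected. -/
structure IsPrimeDivisor (A : Set X) : Prop where
  analytic : IsAnalyticSubset A
  connected : IsConnected (hypersurfaceLocus A)
  dense : A ⊆ closure (hypersurfaceLocus A)

/-- `E` is an irreducible component of codimension one of the analytic subset `A`:
the closure of a connected component of the regular part of `A`. -/
def IsDivisorComponent (A E : Set X) : Prop :=
  ∃ x ∈ hypersurfaceLocus A, E = closure (connectedComponentIn (hypersurfaceLocus A) x)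

/-- Near `x`, the function `w` is a holomorphic multiple of the `k`-th power of a holomorphic
function vanishing on `A`. At a point where `A` is a smooth hypersurface `{z₀ = 0}`, it says
that `z₀ ^ k` divides `w`, that is, that `w` vanishes to order at least `k` along `A`. -/
def VanishesToOrder (A : Set X) (x : X) (k : ℕ) (w : X → ℂ) : Prop :=
  ∃ h u : X → ℂ, HolAt h x ∧ HolAt u x ∧ (∀ᶠ y in 𝓝 x, y ∈ A → h y = 0) ∧
    w =ᶠ[𝓝 x] fun y => u y * h y ^ k

end Basic

/-- Complex varieties, irreducible, reduced and normal: Hausdorff reduced complex spaces with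
connected (and non-empty) regular locus, all of whose local rings are integrally closed domains. -/
structure IsNormalVariety (X : Type*) [TopologicalSpace X] [ComplexSpace X] : Prop where
  t2 : T2Space X
  irreducible : IsConnected (regularLocus X)
  normal : ∀ x : X, IsDomain (holGerms x) ∧ IsIntegrallyClosed (holGerms x)

section Product

variable {X : Type*} [TopologicalSpace X] {Y : Type*} [TopologicalSpace Y]

theorem analyticAt_append {n m : ℕ} (p : (Fin n → ℂ) × (Fin m → ℂ)) :
    AnalyticAt ℂ (fun q : (Fin n → ℂ) × (Fin m → ℂ) => (Fin.append q.1 q.2 : Fin (n + m) → ℂ)) p := by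
  rw [analyticAt_pi_iff]
  intro i
  refine Fin.addCases (fun i => ?_) (fun i => ?_) i
  · simp only [Fin.append_left]
    exact ((ContinuousLinearMap.proj (R := ℂ) (φ := fun _ : Fin n => ℂ) i).comp
      (ContinuousLinearMap.fst ℂ (Fin n → ℂ) (Fin m → ℂ))).analyticAt p
  · simp only [Fin.append_right]
    exact ((ContinuousLinearMap.proj (R := ℂ) (φ := fun _ : Fin m => ℂ) i).comp
      (ContinuousLinearMap.snd ℂ (Fin n → ℂ) (Fin m → ℂ))).analyticAt p

/-- The first projection of `ℂⁿ⁺ᵐ = ℂⁿ × ℂᵐ`. -/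
def splitFst {n m : ℕ} (z : Fin (n + m) → ℂ) : Fin n → ℂ := fun i => z (Fin.castAdd m i)

/-- The second projection of `ℂⁿ⁺ᵐ = ℂⁿ × ℂᵐ`. -/
def splitSnd {n m : ℕ} (z : Fin (n + m) → ℂ) : Fin m → ℂ := fun i => z (Fin.natAdd n i)

theorem splitFst_append {n m : ℕ} (a : Fin n → ℂ) (b : Fin m → ℂ) :
    splitFst (Fin.append a b) = a := by
  funext i; simp [splitFst]

theorem splitSnd_append {n m : ℕ} (a : Fin n → ℂ) (b : Fin m → ℂ) :
    splitSnd (Fin.append a b) = b := by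
  funext i; simp [splitSnd]

theorem append_split {n m : ℕ} (z : Fin (n + m) → ℂ) :
    Fin.append (splitFst z) (splitSnd z) = z := by
  funext i
  refine Fin.addCases (fun i => ?_) (fun i => ?_) i <;> simp [splitFst, splitSnd]

theorem analyticAt_splitFst {n m : ℕ} (z : Fin (n + m) → ℂ) :
    AnalyticAt ℂ (splitFst (n := n) (m := m)) z := by
  rw [analyticAt_pi_iff]
  exact fun i => (ContinuousLinearMap.proj (R := ℂ) (φ := fun _ : Fin (n + m) => ℂ)
    (Fin.castAdd m i)).analyticAt z

theorem analyticAt_splitSnd {n m : ℕ} (z : Fin (n + m) → ℂ) :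
    AnalyticAt ℂ (splitSnd (n := n) (m := m)) z := by
  rw [analyticAt_pi_iff]
  exact fun i => (ContinuousLinearMap.proj (R := ℂ) (φ := fun _ : Fin (n + m) => ℂ)
    (Fin.natAdd n i)).analyticAt z

theorem continuous_splitFst {n m : ℕ} : Continuous (splitFst (n := n) (m := m)) :=
  continuous_pi fun _ => continuous_apply _

theorem continuous_splitSnd {n m : ℕ} : Continuous (splitSnd (n := n) (m := m)) :=
  continuous_pi fun _ => continuous_apply _

/-- Holomorphic germs on a product: the holomorphic functions of finitely many
holomorphic germs on the two factors. -/
def ProdHolAt (HX : (X → ℂ) → X → Prop) (HY : (Y → ℂ) → Y → Prop) (w : X × Y → ℂ) (p : X × Y) :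
    Prop :=
  ∃ (n m : ℕ) (u : Fin n → X → ℂ) (v : Fin m → Y → ℂ) (G : (Fin n → ℂ) × (Fin m → ℂ) → ℂ),
    (∀ i, HX (u i) p.1) ∧ (∀ j, HY (v j) p.2) ∧
    AnalyticAt ℂ G (fun i => u i p.1, fun j => v j p.2) ∧
    w =ᶠ[𝓝 p] fun q => G (fun i => u i q.1, fun j => v j q.2)

theorem IsLocalModel.prod {HX : (X → ℂ) → X → Prop} {HY : (Y → ℂ) → Y → Prop} {n m : ℕ}
    {U : Set X} {φ : X → (Fin n → ℂ)} {Ω : Set (Fin n → ℂ)}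
    {V : Set Y} {ψ : Y → (Fin m → ℂ)} {Θ : Set (Fin m → ℂ)}
    (h : IsLocalModel HX n U φ Ω) (k : IsLocalModel HY m V ψ Θ) :
    IsLocalModel (ProdHolAt HX HY) (n + m) (U ×ˢ V) (fun p => Fin.append (φ p.1) (ψ p.2))
      {z | splitFst z ∈ Ω ∧ splitSnd z ∈ Θ} where
  isOpen_source := h.isOpen_source.prod k.isOpen_source
  isOpen_ambient := (h.isOpen_ambient.preimage continuous_splitFst).inter
    (k.isOpen_ambient.preimage continuous_splitSnd)
  isEmbedding := by
    have e1 : IsEmbedding (fun p : ↥(U ×ˢ V) =>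
        ((⟨p.1.1, p.2.1⟩ : U), (⟨p.1.2, p.2.2⟩ : V))) := by
      refine IsEmbedding.of_comp (g := Prod.map Subtype.val Subtype.val) ?_ ?_ ?_
      · exact Continuous.prodMk
          ((continuous_fst.comp continuous_subtype_val).subtype_mk _)
          ((continuous_snd.comp continuous_subtype_val).subtype_mk _)
      · exact continuous_subtype_val.prodMap continuous_subtype_val
      · exact IsEmbedding.subtypeVal
    have e2 := h.isEmbedding.prodMap k.isEmbedding
    have e3 : IsEmbedding (fun q : (Fin n → ℂ) × (Fin m → ℂ) =>
        (Fin.append q.1 q.2 : Fin (n + m) → ℂ)) := by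
      refine IsEmbedding.of_leftInverse (f := fun z => (splitFst z, splitSnd z)) ?_ ?_ ?_
      · intro q
        simp only [splitFst_append, splitSnd_append]
      · exact continuous_splitFst.prodMk continuous_splitSnd
      · exact continuous_iff_continuousAt.2 fun q => (analyticAt_append q).continuousAt
    exact e3.comp (e2.comp e1)
  image_analytic := by
    obtain ⟨S, hS, hSa, hSe⟩ := h.image_analytic
    obtain ⟨T, hT, hTa, hTe⟩ := k.image_analytic
    refine ⟨(fun g z => g (splitFst z)) '' S ∪ (fun g z => g (splitSnd z)) '' T,
      (hS.image _).union (hT.image _), ?_, ?_⟩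
    · rintro _ (⟨g, hg, rfl⟩ | ⟨g, hg, rfl⟩) z hz
      · exact (hSa g hg _ hz.1).comp (analyticAt_splitFst z)
      · exact (hTa g hg _ hz.2).comp (analyticAt_splitSnd z)
    · ext z
      constructor
      · rintro ⟨⟨x, y⟩, ⟨hx, hy⟩, rfl⟩
        have h1 : φ x ∈ φ '' U := ⟨x, hx, rfl⟩
        have h2 : ψ y ∈ ψ '' V := ⟨y, hy, rfl⟩
        rw [hSe] at h1
        rw [hTe] at h2
        refine ⟨⟨?_, ?_⟩, ?_⟩
        · simpa only [splitFst_append] using h1.1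
        · simpa only [splitSnd_append] using h2.1
        · rintro _ (⟨g, hg, rfl⟩ | ⟨g, hg, rfl⟩)
          · simpa only [splitFst_append] using h1.2 g hg
          · simpa only [splitSnd_append] using h2.2 g hg
      · rintro ⟨⟨h1, h2⟩, h3⟩
        have h4 : splitFst z ∈ φ '' U := by
          rw [hSe]
          exact ⟨h1, fun g hg => h3 _ (Or.inl ⟨g, hg, rfl⟩)⟩
        have h5 : splitSnd z ∈ ψ '' V := by
          rw [hTe]
          exact ⟨h2, fun g hg => h3 _ (Or.inr ⟨g, hg, rfl⟩)⟩
        obtain ⟨x, hx, ex⟩ := h4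
        obtain ⟨y, hy, ey⟩ := h5
        refine ⟨(x, y), ⟨hx, hy⟩, ?_⟩
        simp only [ex, ey, append_split]
  hol_iff := by
    rintro ⟨x, y⟩ ⟨hx, hy⟩ w
    constructor
    · rintro ⟨a, b, u, v, G, hu, hv, hG, e⟩
      choose A hA eA using fun i => (h.hol_iff x hx (u i)).1 (hu i)
      choose B hB eB using fun j => (k.hol_iff y hy (v j)).1 (hv j)
      refine ⟨fun z => G (fun i => A i (splitFst z), fun j => B j (splitSnd z)), ?_, ?_⟩
      · refine AnalyticAt.fun_comp ?_ (AnalyticAt.prod ?_ ?_)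
        · simp only [splitFst_append, splitSnd_append]
          have e1 : (fun i => A i (φ x)) = fun i => u i x := by
            funext i; exact (eA i).self_of_nhds.symm
          have e2 : (fun j => B j (ψ y)) = fun j => v j y := by
            funext j; exact (eB j).self_of_nhds.symm
          rw [e1, e2]
          exact hG
        · rw [analyticAt_pi_iff]
          intro i
          refine AnalyticAt.fun_comp ?_ (analyticAt_splitFst _)
          rw [splitFst_append]
          exact hA i
        · rw [analyticAt_pi_iff]
          intro j
          refine AnalyticAt.fun_comp ?_ (analyticAt_splitSnd _)
          rw [splitSnd_append]
          exact hB j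
      · have E1 : ∀ᶠ q : X × Y in 𝓝 (x, y), ∀ i, u i q.1 = A i (φ q.1) :=
          eventually_all.2 fun i => (continuous_fst.tendsto (x, y)).eventually (eA i)
        have E2 : ∀ᶠ q : X × Y in 𝓝 (x, y), ∀ j, v j q.2 = B j (ψ q.2) :=
          eventually_all.2 fun j => (continuous_snd.tendsto (x, y)).eventually (eB j)
        filter_upwards [e, E1, E2] with q hq h1 h2
        rw [hq]
        simp only [splitFst_append, splitSnd_append, h1, h2]
    · rintro ⟨G, hG, e⟩
      refine ⟨n, m, fun i x' => φ x' i, fun j y' => ψ y' j, fun q => G (Fin.append q.1 q.2),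
        fun i => (h.hol_iff x hx _).2 ⟨fun z => z i, ?_, Eventually.of_forall fun _ => rfl⟩,
        fun j => (k.hol_iff y hy _).2 ⟨fun z => z j, ?_, Eventually.of_forall fun _ => rfl⟩, ?_, e⟩
      · exact (ContinuousLinearMap.proj (R := ℂ) (φ := fun _ : Fin n => ℂ) i).analyticAt _
      · exact (ContinuousLinearMap.proj (R := ℂ) (φ := fun _ : Fin m => ℂ) j).analyticAt _
      · exact AnalyticAt.fun_comp hG (analyticAt_append _)

/-- The product of two reduced complex spaces. -/
instance instProd [ComplexSpace X] [ComplexSpace Y] : ComplexSpace (X × Y) where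
  HolAt := ProdHolAt HolAt HolAt
  exists_localModel := by
    rintro ⟨x, y⟩
    obtain ⟨n, U, φ, Ω, hx, h⟩ := exists_localModel x
    obtain ⟨m, V, ψ, Θ, hy, k⟩ := exists_localModel y
    exact ⟨_, _, _, _, mk_mem_prod hx hy, IsLocalModel.prod h k⟩

end Product

section Maps

variable {X : Type*} [TopologicalSpace X] [ComplexSpace X]
  {Y : Type*} [TopologicalSpace Y] [ComplexSpace Y]

/-- Holomorphic maps between reduced complex spaces. -/
structure IsHolomorphicMap (f : X → Y) : Prop where
  continuous : Continuous f
  holAt_comp : ∀ (x : X) (g : Y → ℂ), HolAt g (f x) → HolAt (fun x' => g (f x')) x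

variable (X Y) in
/-- The set `Hol(X, Y)` of holomorphic maps from `X` to `Y`. -/
structure HolMap where
  toFun : X → Y
  isHolomorphicMap : IsHolomorphicMap toFun

/-- The continuous map underlying a holomorphic map. -/
def HolMap.toContinuousMap (f : HolMap X Y) : C(X, Y) :=
  ⟨f.toFun, f.isHolomorphicMap.continuous⟩

/-- `Hol(X, Y)` carries the compact-open topology. -/
instance HolMap.instTopologicalSpace : TopologicalSpace (HolMap X Y) :=
  TopologicalSpace.induced HolMap.toContinuousMap inferInstance

/-- The evaluation map `X × F → Y`, `(x, f) ↦ f x`, of a family `F` of holomorphic maps. -/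
def evalMap (F : Set (HolMap X Y)) (p : X × F) : Y :=
  p.2.1.toFun p.1

/-- The order at `x` of the pull-back `f^* D` along `f⁻¹(D)`: the largest `k` such that `g ∘ f`
vanishes to order at least `k` along `f⁻¹(D)` for every holomorphic germ `g` at `f x` which
vanishes on `D` (if `D` is Cartier, it is enough to take for `g` a local equation of `D`). -/
noncomputable def pullbackOrderAt (f : X → Y) (D : Set Y) (x : X) : ℕ∞ :=
  ⨆ (k : ℕ) (_ : ∀ g : Y → ℂ, HolAt g (f x) → (∀ᶠ y in 𝓝 (f x), y ∈ D → g y = 0) →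
    VanishesToOrder (f ⁻¹' D) x k fun x' => g (f x')), (k : ℕ∞)

/-- The multiplicity `t` of the component `E` of `f⁻¹(D)` in the pull-back `f^* D = t E + R`: the
order of `f^* D` at the points of `E` where `f⁻¹(D)` is a smooth hypersurface
(the order is the same at all these points). -/
noncomputable def pullbackMultiplicity (f : X → Y) (D : Set Y) (E : Set X) : ℕ∞ :=
  ⨅ x ∈ E ∩ hypersurfaceLocus (f ⁻¹' D), pullbackOrderAt f D x

variable (X) in
/-- The boundary `Δ = ∑ (1 - 1 / m_D) D` of an orbifold pair `(X, Δ)`, recorded by its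
orbifold multiplicities `m_D`, with `m_D = 1` for the prime divisors `D` that do not occur. -/
structure OrbifoldDivisor where
  mult : Set X → ℕ∞
  one_le_mult : ∀ D, 1 ≤ mult D
  isPrimeDivisor : ∀ D, mult D ≠ 1 → IsPrimeDivisor D
  locallyFinite : LocallyFinite fun D : {D : Set X // mult D ≠ 1} => (D : Set X)

/-- The support `⌈Δ⌉`. -/
def OrbifoldDivisor.support (Δ : OrbifoldDivisor X) : Set X :=
  {x | ∃ D : Set X, Δ.mult D ≠ 1 ∧ x ∈ D}

variable (X) in
/-- The zero boundary: no orbifold structure. -/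
def OrbifoldDivisor.trivial : OrbifoldDivisor X where
  mult _ := 1
  one_le_mult _ := le_rfl
  isPrimeDivisor _ h := absurd rfl h
  locallyFinite := by
    have : IsEmpty {D : Set X // (1 : ℕ∞) ≠ 1} := ⟨fun D => D.2 rfl⟩
    exact fun x => ⟨univ, univ_mem, Set.toFinite _⟩

/-- Orbifold morphisms `(X, ΔX) → (Y, ΔY)`: holomorphic maps `f` with `f(X) ⊄ ⌈ΔY⌉` such that
`t * m_X(E) ≥ m_Y(D)` whenever `f^* D = t E + R` with prime divisors `D` of `Y`, `E` of `X`
and `R` an effective divisor not containing `E`. -/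
structure IsOrbifoldMorphism (ΔX : OrbifoldDivisor X) (ΔY : OrbifoldDivisor Y) (f : X → Y) :
    Prop where
  isHolomorphicMap : IsHolomorphicMap f
  not_subset_support : ¬ range f ⊆ ΔY.support
  mult_le : ∀ D : Set Y, IsPrimeDivisor D → ∀ E : Set X, IsDivisorComponent (f ⁻¹' D) E →
    ΔY.mult D ≤ pullbackMultiplicity f D E * ΔX.mult E

end Maps

end ComplexSpace

/-! The order of `ev^* D` need only be bounded at points where `ev⁻¹(D)` is a smooth hypersurface
`Φ₀ = 0` in local coordinates of `X × F`. Let `g` vanish on `D` and suppose `g ∘ ev = Φ₀ ^ j * v`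
with `j` below the multiplicity of `D`; another factor `Φ₀` splits off as soon as `v` vanishes on
`Φ₀ = 0`.

Take a point `(x, f)` of the hypersurface where some derivative of `Φ₀` in an `X`-direction is
non-zero. There `f⁻¹(D)` is smooth with equation `Φ₀(·, f)`, and the orbifold condition on `f`
forces `v(x, f) = 0` (`IsOrbifoldMorphism.eq_zero_of_pow_mul`). Hence `v * ∂Φ₀` vanishes on the
hypersurface for every `X`-derivative. The germ of a smooth hypersurface is irreducible, so either
`v` vanishes on it or all `X`-derivatives of `Φ₀` do. In the second case these derivatives are
multiples of `Φ₀`, and `Φ₀(·, f₀)`, being zero at `x₀`, vanishes near `x₀`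
(`eventually_eq_zero_of_fderiv_eq_mul`). By the identity theorem `IsAnalyticSubset.eq_univ`, `f₀`
then maps `X` into `D`, against `f₀(X) ⊄ ⌈Δ⌉`.

To speak of `X`-derivatives one needs coordinates on the factors: `mem_regularLocus_of_prod` shows
that a regular point of a product has regular components. That lemma and the density of regular
points both rest on local models of minimal embedding dimension. -/

namespace AnalyticGerm

/-! ### Division of analytic functions by a linear form -/

section Hadamard

variable {E : Type*} [NormedAddCommGroup E] [NormedSpace ℂ E]

/-- The `n`-th coefficient of the quotient by `ℓ` of the difference of a power series
at `h` and at its projection to the kernel of `ℓ`. -/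
noncomputable def quotientSeries (p : FormalMultilinearSeries ℂ E ℂ) (e : E) (π : E →L[ℂ] E) :
    FormalMultilinearSeries ℂ E ℂ := fun n =>
  ∑ i : Fin (n + 1), ((p (n + 1)).curryMid i e).compContinuousLinearMap
    fun j : Fin n => if (i.succAbove j : Fin (n + 1)) < i then π else ContinuousLinearMap.id ℂ E

/-- Telescoping: the arguments `h` are replaced by `π h` one slot at a time, and each replacement
costs a term with `h - π h = ℓ h • e` in that slot. -/
theorem mul_quotientSeries (p : FormalMultilinearSeries ℂ E ℂ) (e : E) (π : E →L[ℂ] E)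
    (ℓ : E →L[ℂ] ℂ) (hπ : ∀ h, h - π h = ℓ h • e) (n : ℕ) (h : E) :
    ℓ h * quotientSeries p e π n (fun _ => h) =
      p (n + 1) (fun _ => h) - p (n + 1) (fun _ => π h) := by
  -- `A i` has `π h` in the first `i` slots and `h` in the others, so `A i - A (i + 1)` is `ℓ h`
  -- times the `i`-th summand of the quotient.
  set A : ℕ → ℂ := fun i => p (n + 1) fun j => if (j : ℕ) < i then π h else h with hA
  have h0 : A 0 = p (n + 1) fun _ => h := by simp [hA]
  have h1 : A (n + 1) = p (n + 1) fun _ => π h := by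
    simp only [hA]
    congr 1
    funext j
    simp [j.2]
  rw [← h0, ← h1, ← Finset.sum_range_sub' A (n + 1), Finset.sum_range, quotientSeries,
    sum_apply, Finset.mul_sum]
  refine Finset.sum_congr rfl fun i _ => ?_
  have key : ∀ x : E, (i.insertNth x fun j : Fin n =>
      (if (i.succAbove j : Fin (n + 1)) < i then π else ContinuousLinearMap.id ℂ E) h : Fin (n + 1) → E)
      = Function.update (fun j : Fin (n + 1) => if (j : ℕ) < i then π h else h) i x := by
    intro x
    funext j
    refine Fin.succAboveCases i ?_ (fun j => ?_) j
    · simp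
    · rw [Fin.insertNth_apply_succAbove, Function.update_of_ne (Fin.succAbove_ne i j)]
      by_cases hj : i.succAbove j < i
      · rw [if_pos hj, if_pos (by exact hj)]
      · rw [if_neg hj, if_neg (by exact hj)]; rfl
  have e1 : A i = p (n + 1) (Function.update
      (fun j : Fin (n + 1) => if (j : ℕ) < i then π h else h) i h) := by
    simp only [hA]
    congr 1
    rw [eq_comm, Function.update_eq_self_iff]
    simp
  have e2 : A (i + 1) = p (n + 1) (Function.update
      (fun j : Fin (n + 1) => if (j : ℕ) < i then π h else h) i (π h)) := by
    simp only [hA]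
    congr 1
    funext j
    rcases eq_or_ne j i with rfl | hj
    · simp
    · rw [Function.update_of_ne hj]
      have : (j : ℕ) ≠ i := fun h => hj (Fin.ext h)
      have : ((j : ℕ) < i + 1) ↔ ((j : ℕ) < i) := by omega
      simp only [this]
  rw [ContinuousMultilinearMap.compContinuousLinearMap_apply,
    ContinuousMultilinearMap.curryMid_apply, key, e1, e2,
    ← ContinuousMultilinearMap.map_update_sub, hπ, ContinuousMultilinearMap.map_update_smul,
    smul_eq_mul]

theorem norm_quotientSeries_le (p : FormalMultilinearSeries ℂ E ℂ) (e : E) (π : E →L[ℂ] E)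
    (n : ℕ) : ‖quotientSeries p e π n‖ ≤ (n + 1) * (‖p (n + 1)‖ * ‖e‖ * (1 + ‖π‖) ^ n) := by
  refine (norm_sum_le _ _).trans ?_
  refine (Finset.sum_le_card_nsmul _ _ (‖p (n + 1)‖ * ‖e‖ * (1 + ‖π‖) ^ n) fun i _ => ?_).trans ?_
  · refine (ContinuousMultilinearMap.norm_compContinuousLinearMap_le _ _).trans ?_
    refine mul_le_mul ?_ ?_ (Finset.prod_nonneg fun _ _ => norm_nonneg _) (by positivity)
    · refine (ContinuousLinearMap.le_opNorm _ _).trans ?_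
      rw [ContinuousMultilinearMap.norm_curryMid]
    · refine (Finset.prod_le_prod (g := fun _ => 1 + ‖π‖) (fun _ _ => norm_nonneg _)
        fun j _ => ?_).trans (by simp)
      split_ifs
      · linarith
      · exact ContinuousLinearMap.norm_id_le.trans (by linarith [norm_nonneg π])
  · simp

theorem radius_quotientSeries_pos {p : FormalMultilinearSeries ℂ E ℂ} (hp : 0 < p.radius) (e : E)
    (π : E →L[ℂ] E) : 0 < (quotientSeries p e π).radius := by
  obtain ⟨C, r, hC, hr, hb⟩ := p.le_mul_pow_of_radius_pos hp
  -- The factor `2` absorbs the number `n + 1 ≤ 2 ^ n` of summands, and `1 + ‖π‖` bounds the norms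
  -- of both `π` and the identity.
  set M : ℝ := 2 * r * (1 + ‖π‖) with hM
  have hMpos : 0 < M := by positivity
  have hs : 0 < (M⁻¹).toNNReal := by simpa using hMpos
  refine lt_of_lt_of_le (ENNReal.coe_pos.2 hs)
    (FormalMultilinearSeries.le_radius_of_bound _ (C * r * ‖e‖) fun n => ?_)
  rw [Real.coe_toNNReal _ (by positivity)]
  have h2 : ((n : ℝ) + 1) ≤ 2 ^ n := by
    exact_mod_cast Nat.lt_two_pow_self (n := n)
  have : ‖quotientSeries p e π n‖ ≤ (C * r * ‖e‖) * M ^ n := by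
    calc ‖quotientSeries p e π n‖ ≤ (n + 1) * (‖p (n + 1)‖ * ‖e‖ * (1 + ‖π‖) ^ n) :=
          norm_quotientSeries_le p e π n
      _ ≤ 2 ^ n * ((C * r ^ (n + 1)) * ‖e‖ * (1 + ‖π‖) ^ n) := by
          gcongr
          exact hb _
      _ = _ := by rw [hM, mul_pow, mul_pow]; ring
  calc ‖quotientSeries p e π n‖ * M⁻¹ ^ n ≤ (C * r * ‖e‖) * M ^ n * M⁻¹ ^ n := by gcongr
    _ = C * r * ‖e‖ := by rw [mul_assoc, ← mul_pow, mul_inv_cancel₀ hMpos.ne', one_pow, mul_one]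

/-- An analytic function vanishing on a hyperplane is divisible by the equation of
the hyperplane. -/
theorem exists_eq_mul_of_vanishing {G : E → ℂ} {z : E} (hG : AnalyticAt ℂ G z) (ℓ : E →L[ℂ] ℂ)
    {e : E} (he : ℓ e = 1) (h0 : ∀ᶠ y in 𝓝 z, ℓ y = ℓ z → G y = 0) :
    ∃ Q : E → ℂ, AnalyticAt ℂ Q z ∧ ∀ᶠ y in 𝓝 z, G y = ℓ (y - z) * Q y := by
  obtain ⟨p, r, hp⟩ := hG
  -- The projection to `ker ℓ` along `e`. Since `G` vanishes at `z + π (y - z)`, subtracting its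
  -- expansion there from the one at `y` changes nothing, and `ℓ (y - z)` divides the difference
  -- term by term.
  set π : E →L[ℂ] E := ContinuousLinearMap.id ℂ E - ℓ.smulRight e with hπd
  have hπ : ∀ h, h - π h = ℓ h • e := fun h => by simp [hπd]
  have hℓπ : ∀ h, ℓ (π h) = 0 := fun h => by simp [hπd, he]
  set q := quotientSeries p e π
  have hq : HasFPowerSeriesOnBall (fun y => q.sum (y - z)) q z q.radius := by
    simpa using (q.hasFPowerSeriesOnBall
      (radius_quotientSeries_pos (hp.r_pos.trans_le hp.r_le) e π)).comp_sub z
  refine ⟨_, hq.analyticAt, ?_⟩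
  have t1 : Tendsto (fun y => z + π (y - z)) (𝓝 z) (𝓝 z) := by
    have : Continuous fun y => z + π (y - z) := by fun_prop
    simpa using this.tendsto z
  filter_upwards [t1.eventually h0, Metric.eball_mem_nhds z hp.r_pos,
    t1 (Metric.eball_mem_nhds z hp.r_pos), Metric.eball_mem_nhds z hq.r_pos] with y hy0 hy1 hy2 hy3
  have hy0' := hy0 (by simp [hℓπ])
  have s1 := hp.hasSum_sub hy1
  have s2 := hp.hasSum_sub hy2
  rw [hy0'] at s2
  have s3 := s1.sub s2
  have s4 := (hasSum_nat_add_iff' 1).2 s3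
  have s5 := (hq.hasSum_sub hy3).mul_left (ℓ (y - z))
  have hz : p 0 (fun _ => y - z) = p 0 (fun _ => z + π (y - z) - z) := by
    congr 1
    funext i
    exact i.elim0
  rw [Finset.sum_range_one, hz, sub_self, sub_zero, sub_zero] at s4
  refine HasSum.unique s4 ?_
  have e5 : (fun n => ℓ (y - z) * q n fun _ => y - z) = fun n =>
      (p (n + 1) fun _ => y - z) - p (n + 1) fun _ => z + π (y - z) - z := by
    funext n
    rw [mul_quotientSeries p e π ℓ hπ, add_sub_cancel_left]
  rwa [e5] at s5

end Hadamard

/-! ### Vanishing criteria for analytic germs -/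

section Vanishing

variable {E : Type*} [NormedAddCommGroup E] [NormedSpace ℂ E]

theorem exists_ball_analyticOnNhd {F : Type*} [NormedAddCommGroup F] [NormedSpace ℂ F]
    [CompleteSpace F] {G : E → F} {z : E} (hG : AnalyticAt ℂ G z) :
    ∃ r > 0, AnalyticOnNhd ℂ G (Metric.ball z r) := by
  obtain ⟨r, hr, h⟩ := Metric.eventually_nhds_iff_ball.1 hG.eventually_analyticAt
  exact ⟨r, hr, h⟩

theorem isPreconnected_ball (z : E) (r : ℝ) : IsPreconnected (Metric.ball z r) :=
  let _ := NormedSpace.restrictScalars ℝ ℂ E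
  (convex_ball z r).isPreconnected

/-- The ring of germs of analytic functions has no zero divisors. -/
theorem eventually_eq_zero_or {A B : E → ℂ} {z : E} (hA : AnalyticAt ℂ A z)
    (hB : AnalyticAt ℂ B z) (h : ∀ᶠ y in 𝓝 z, A y * B y = 0) :
    (∀ᶠ y in 𝓝 z, A y = 0) ∨ ∀ᶠ y in 𝓝 z, B y = 0 := by
  obtain ⟨r, hr, hAB⟩ := Metric.eventually_nhds_iff_ball.1
    ((hA.eventually_analyticAt.and hB.eventually_analyticAt).and h)
  by_cases hz : ∀ y ∈ Metric.ball z r, A y = 0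
  · exact Or.inl (Metric.eventually_nhds_iff_ball.2 ⟨r, hr, hz⟩)
  · push Not at hz
    obtain ⟨y, hy, hAy⟩ := hz
    have hBy : B =ᶠ[𝓝 y] 0 := by
      filter_upwards [(hAB y hy).1.1.continuousAt.eventually_ne hAy,
        Metric.isOpen_ball.mem_nhds hy] with x hx hx'
      exact (mul_eq_zero.1 (hAB x hx').2).resolve_left hx
    exact Or.inr (Metric.eventually_nhds_iff_ball.2 ⟨r, hr,
      AnalyticOnNhd.eqOn_zero_of_preconnected_of_eventuallyEq_zero
        (fun x hx => (hAB x hx).1.2) (isPreconnected_ball z r) hy hBy⟩)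

theorem analyticAt_line (z v : E) (t : ℂ) : AnalyticAt ℂ (fun t : ℂ => z + t • v) t :=
  analyticAt_const.add (analyticAt_id.smul analyticAt_const)

/-- An analytic function which vanishes near `z` on every line through `z` vanishes near `z`. -/
theorem eventually_eq_zero_of_lines {G : E → ℂ} {z : E} (hG : AnalyticAt ℂ G z)
    (h : ∀ v : E, ∀ᶠ t : ℂ in 𝓝 0, G (z + t • v) = 0) : ∀ᶠ y in 𝓝 z, G y = 0 := by
  obtain ⟨r, hr, hGr⟩ := exists_ball_analyticOnNhd hG
  refine Metric.eventually_nhds_iff_ball.2 ⟨r, hr, fun y hy => ?_⟩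
  -- The parameters for which the line from `z` through `y` stays in the ball: a convex set
  -- containing `0` and `1`, to which the one-variable identity theorem applies.
  set T : Set ℂ := {t | z + t • (y - z) ∈ Metric.ball z r} with hT
  have hTc : IsPreconnected T := by
    have : Convex ℝ T := by
      let _ := NormedSpace.restrictScalars ℝ ℂ E
      intro a ha b hb α β hα hβ hαβ
      have e : z + (α • a + β • b) • (y - z) =
          α • (z + a • (y - z)) + β • (z + b • (y - z)) := by
        have : z = (α + β) • z := by rw [hαβ, one_smul]
        have h1 : ∀ (c : ℝ) (d : ℂ), (c • d) • (y - z) = c • d • (y - z) := fun c d =>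
          smul_assoc c d _
        nth_rewrite 1 [this]
        rw [add_smul (α • a), h1, h1]
        module
      rw [hT, mem_ofPred_eq, e]
      exact convex_ball z r ha hb hα hβ hαβ
    exact this.isPreconnected
  have hA : AnalyticOnNhd ℂ (fun t : ℂ => G (z + t • (y - z))) T := fun t ht =>
    AnalyticAt.fun_comp (hGr _ ht) (analyticAt_line z _ t)
  have h0 : (0 : ℂ) ∈ T := by simpa [hT] using hr
  have h1 : (1 : ℂ) ∈ T := by simpa [hT, ← dist_eq_norm] using hy
  simpa using hA.eqOn_zero_of_preconnected_of_eventuallyEq_zero hTc h0 (h _) h1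

theorem hasDerivAt_line {G : E → ℂ} {z v : E} {t : ℂ} (hG : AnalyticAt ℂ G (z + t • v)) :
    HasDerivAt (fun t : ℂ => G (z + t • v)) (fderiv ℂ G (z + t • v) v) t := by
  refine hG.differentiableAt.hasFDerivAt.comp_hasDerivAt t ?_
  simpa using ((hasDerivAt_id t).smul_const v).const_add z

/-- An analytic function whose derivative is a multiple of the function vanishes near each of
its zeros. -/
theorem eventually_eq_zero_of_fderiv_eq_mul {G : E → ℂ} {z : E} (hG : AnalyticAt ℂ G z)
    (hz : G z = 0)
    (h : ∀ v : E, ∃ q : E → ℂ, AnalyticAt ℂ q z ∧ ∀ᶠ y in 𝓝 z, fderiv ℂ G y v = G y * q y) :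
    ∀ᶠ y in 𝓝 z, G y = 0 := by
  refine eventually_eq_zero_of_lines hG fun v => ?_
  obtain ⟨q, hq, e⟩ := h v
  have hl := analyticAt_line z v 0
  have hl0 : z + (0 : ℂ) • v = z := by simp
  have hGl : AnalyticAt ℂ (fun t : ℂ => G (z + t • v)) 0 :=
    AnalyticAt.fun_comp (by rwa [hl0]) hl
  have hql : AnalyticAt ℂ (fun t : ℂ => q (z + t • v)) 0 :=
    AnalyticAt.fun_comp (by rwa [hl0]) hl
  have ht : Tendsto (fun t : ℂ => z + t • v) (𝓝 0) (𝓝 z) := by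
    simpa using hl.continuousAt.tendsto
  have hd : deriv (fun t : ℂ => G (z + t • v)) =ᶠ[𝓝 0]
      (fun t : ℂ => G (z + t • v)) * fun t : ℂ => q (z + t • v) := by
    filter_upwards [ht.eventually e, ht.eventually hG.eventually_analyticAt] with t h1 h2
    rw [(hasDerivAt_line h2).deriv, h1]
    rfl
  -- Along a line, differentiation lowers a finite positive order of vanishing by one, whereas
  -- multiplication by `q` cannot lower it; so the order is infinite.
  have ho := hGl.analyticOrderAt_deriv_add_one
  rw [analyticOrderAt_congr hd, analyticOrderAt_mul hGl hql] at ho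
  simp only [hl0, hz, sub_zero] at ho
  by_contra hne
  have hfin : analyticOrderAt (fun t : ℂ => G (z + t • v)) 0 ≠ ⊤ := by
    rwa [Ne, analyticOrderAt_eq_top]
  generalize analyticOrderAt (fun t : ℂ => G (z + t • v)) 0 = a at ho hfin
  generalize analyticOrderAt (fun t : ℂ => q (z + t • v)) 0 = b at ho
  lift a to ℕ using hfin
  cases b with
  | top => simp at ho
  | coe b => norm_cast at ho; omega

/-- If a class of functions which are analytic and vanish at `z` is closed under directional
derivatives, then its members vanish near `z`. -/
theorem eventually_eq_zero_of_derivatives_vanish (C : Set (E → ℂ)) {z : E}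
    (hC : ∀ G ∈ C, AnalyticAt ℂ G z ∧ G z = 0)
    (hd : ∀ G ∈ C, ∀ v : E, (fun y => fderiv ℂ G y v) ∈ C) {G : E → ℂ} (hG : G ∈ C) :
    ∀ᶠ y in 𝓝 z, G y = 0 := by
  refine eventually_eq_zero_of_lines (hC G hG).1 fun v => ?_
  have hl := analyticAt_line z v 0
  have hl0 : z + (0 : ℂ) • v = z := by simp
  have ht : Tendsto (fun t : ℂ => z + t • v) (𝓝 0) (𝓝 z) := by
    simpa using hl.continuousAt.tendsto
  have hlin : ∀ K ∈ C, AnalyticAt ℂ (fun t : ℂ => K (z + t • v)) 0 := fun K hK =>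
    AnalyticAt.fun_comp (by rw [hl0]; exact (hC K hK).1) hl
  -- Every iterated derivative along the line is the restriction of a member of `C`, so all Taylor
  -- coefficients at `0` vanish.
  have key : ∀ n : ℕ, ∃ K ∈ C,
      iteratedDeriv n (fun t : ℂ => G (z + t • v)) =ᶠ[𝓝 0] fun t : ℂ => K (z + t • v) := by
    intro n
    induction n with
    | zero => exact ⟨G, hG, by rw [iteratedDeriv_zero]⟩
    | succ n ih =>
      obtain ⟨K, hK, e⟩ := ih
      refine ⟨_, hd K hK v, ?_⟩
      rw [iteratedDeriv_succ]
      refine e.deriv.trans ?_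
      filter_upwards [ht.eventually (hC K hK).1.eventually_analyticAt] with t ht
      exact (hasDerivAt_line ht).deriv
  have hs := (hlin G hG).hasFPowerSeriesAt
  have h0 : FormalMultilinearSeries.ofScalars ℂ
      (fun n => iteratedDeriv n (fun t : ℂ => G (z + t • v)) 0 / n.factorial) = 0 := by
    ext n
    obtain ⟨K, hK, e⟩ := key n
    have : iteratedDeriv n (fun t : ℂ => G (z + t • v)) 0 = 0 := by
      rw [e.self_of_nhds]
      simpa using (hC K hK).2
    simp [FormalMultilinearSeries.ofScalars, this]
  rw [h0] at hs
  exact hs.eventually_eq_zero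

end Vanishing

theorem analyticAt_coord {n : ℕ} (i : Fin n) (z : Fin n → ℂ) :
    AnalyticAt ℂ (fun y : Fin n → ℂ => y i) z :=
  (ContinuousLinearMap.proj (R := ℂ) (φ := fun _ : Fin n => ℂ) i).analyticAt z

/-! ### Analytic inverse functions and straightening of hypersurfaces -/

section InverseFunction

variable {E F : Type*} [NormedAddCommGroup E] [NormedSpace ℂ E] [NormedAddCommGroup F]
  [NormedSpace ℂ F] [CompleteSpace E] [CompleteSpace F]

/-- The analytic inverse function theorem. -/
theorem exists_openPartialHomeomorph {θ : E → F} {z : E} (hθ : AnalyticAt ℂ θ z) (L : E ≃L[ℂ] F)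
    (hL : fderiv ℂ θ z = L) :
    ∃ e : OpenPartialHomeomorph E F, z ∈ e.source ∧ (∀ y, e y = θ y) ∧
      (∀ y ∈ e.source, AnalyticAt ℂ e y) ∧ ∀ y ∈ e.target, AnalyticAt ℂ e.symm y := by
  have hs : HasStrictFDerivAt θ (L : E →L[ℂ] F) z := hL ▸ hθ.hasStrictFDerivAt
  set R := hs.toOpenPartialHomeomorph θ with hR
  have hz : z ∈ R.source := hs.mem_toOpenPartialHomeomorph_source
  have hRθ : ∀ y, R y = θ y := fun y => rfl
  have hsym : AnalyticAt ℂ R.symm (R z) := R.analyticAt_symm' hz hθ hL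
  -- Analyticity of the inverse is known so far only at the image of `z`; being an open condition,
  -- it holds throughout the source after shrinking.
  set O : Set E := {y | AnalyticAt ℂ θ y} ∩ (R.source ∩ R ⁻¹' {w | AnalyticAt ℂ R.symm w})
  have hO : IsOpen O := (isOpen_analyticAt ℂ θ).inter
    (R.continuousOn.isOpen_inter_preimage R.open_source (isOpen_analyticAt ℂ R.symm))
  refine ⟨R.restrOpen O hO, ⟨hz, hθ, hz, hsym⟩, hRθ, fun y hy => hy.2.1, fun y hy => ?_⟩
  have := (R.restrOpen O hO).map_target hy
  have h2 : AnalyticAt ℂ R.symm (R (R.symm y)) := this.2.2.2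
  have hy' : y ∈ R.target := by
    have := (R.restrOpen O hO).right_inv hy
    exact this ▸ R.map_source ((R.restrOpen O hO).map_target hy).1
  rwa [R.right_inv hy'] at h2

/-- A function with non-zero derivative is the first coordinate of a system of
local coordinates. -/
theorem exists_straightening {n : ℕ} {G : (Fin n → ℂ) → ℂ} {z : Fin n → ℂ}
    (hG : AnalyticAt ℂ G z) (hd : fderiv ℂ G z ≠ 0) :
    ∃ (k : ℕ) (e : OpenPartialHomeomorph (Fin n → ℂ) (Fin (k + 1) → ℂ)), n = k + 1 ∧
      z ∈ e.source ∧ (∀ y, e y 0 = G y) ∧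
      (∀ y ∈ e.source, AnalyticAt ℂ e y) ∧ ∀ y ∈ e.target, AnalyticAt ℂ e.symm y := by
  obtain ⟨i, hi⟩ : ∃ i : Fin n, fderiv ℂ G z (Pi.single i 1) ≠ 0 := by
    by_contra! h
    refine hd (ContinuousLinearMap.coe_injective (LinearMap.pi_ext' fun i => ?_))
    ext
    simpa using h i
  cases n with
  | zero => exact i.elim0
  | succ k =>
    -- The coordinate `i`, along which `G` has non-zero derivative, is discarded and `G` is put in
    -- front of the remaining ones.
    set θ : (Fin (k + 1) → ℂ) → (Fin (k + 1) → ℂ) := fun y =>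
      Fin.cons (G y) fun j => y (i.succAbove j) with hθd
    have hθ : AnalyticAt ℂ θ z := by
      rw [analyticAt_pi_iff]
      refine fun j => Fin.cases ?_ (fun j => ?_) j
      · simpa [hθd] using hG
      · simpa only [hθd, Fin.cons_succ] using analyticAt_coord (i.succAbove j) z
    set A : (Fin (k + 1) → ℂ) →L[ℂ] (Fin (k + 1) → ℂ) := fderiv ℂ θ z with hA
    have hA0 : ∀ v, A v 0 = fderiv ℂ G z v := fun v => by
      have h1 := (hasFDerivAt_pi'.1 hθ.differentiableAt.hasFDerivAt) 0
      have h2 : HasFDerivAt G ((ContinuousLinearMap.proj 0).comp A) z := by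
        simpa [hθd] using h1
      rw [h2.fderiv]
      rfl
    have hA1 : ∀ v j, A v (Fin.succ j) = v (i.succAbove j) := fun v j => by
      have h1 := (hasFDerivAt_pi'.1 hθ.differentiableAt.hasFDerivAt) (Fin.succ j)
      have h2 := hasFDerivAt_apply (𝕜 := ℂ) (F' := fun _ : Fin (k + 1) => ℂ) (i.succAbove j) z
      have h3 := h2.unique (by simpa only [hθd, Fin.cons_succ] using h1)
      exact (congrArg (fun B => B v) h3).symm
    have hinj : Function.Injective A := by
      rw [injective_iff_map_eq_zero]
      intro v hv
      have hv1 : ∀ j, v (i.succAbove j) = 0 := fun j => by rw [← hA1 v, hv]; rfl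
      have hvs : v = v i • Pi.single i 1 := by
        funext j
        refine Fin.succAboveCases i ?_ (fun j => ?_) j
        · simp
        · simp [hv1]
      have h0 : fderiv ℂ G z v = 0 := by rw [← hA0, hv]; rfl
      rw [hvs, map_smul, smul_eq_mul] at h0
      rw [hvs, (mul_eq_zero.1 h0).resolve_right hi, zero_smul]
    obtain ⟨e, h1, h2, h3, h4⟩ := exists_openPartialHomeomorph hθ
      (LinearEquiv.ofInjectiveEndo A.toLinearMap hinj).toContinuousLinearEquiv
      (by ext; simp [hA])
    exact ⟨k, e, rfl, h1, fun y => by rw [h2]; simp [hθd], h3, h4⟩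

end InverseFunction

end AnalyticGerm

namespace ComplexSpace

/-! ### Operations on local models -/

section LocalModels

variable {X : Type*} [TopologicalSpace X] {H : (X → ℂ) → X → Prop} {n : ℕ} {U : Set X}
  {φ : X → (Fin n → ℂ)} {Ω : Set (Fin n → ℂ)}

theorem _root_.IsLocalModel.mem_ambient (h : IsLocalModel H n U φ Ω) {x : X} (hx : x ∈ U) :
    φ x ∈ Ω := by
  obtain ⟨S, -, -, e⟩ := h.image_analytic
  have : φ x ∈ φ '' U := ⟨x, hx, rfl⟩
  rw [e] at this
  exact this.1

theorem _root_.IsLocalModel.continuousOn (h : IsLocalModel H n U φ Ω) : ContinuousOn φ U :=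
  continuousOn_iff_continuous_domRestrict.2 h.isEmbedding.continuous

theorem _root_.IsLocalModel.injOn (h : IsLocalModel H n U φ Ω) : InjOn φ U :=
  injOn_iff_injective.2 h.isEmbedding.injective

theorem _root_.IsLocalModel.continuousAt (h : IsLocalModel H n U φ Ω) {x : X} (hx : x ∈ U) :
    ContinuousAt φ x :=
  h.continuousOn.continuousAt (h.isOpen_source.mem_nhds hx)

/-- Open subsets of the domain of a local model are cut out by open subsets of `ℂⁿ`. -/
theorem _root_.IsLocalModel.exists_isOpen (h : IsLocalModel H n U φ Ω) {V : Set X}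
    (hV : IsOpen V) : ∃ O : Set (Fin n → ℂ), IsOpen O ∧ ∀ x ∈ U, x ∈ V ↔ φ x ∈ O := by
  obtain ⟨O, hO, e⟩ := h.isEmbedding.isOpen_iff.1 (hV.preimage (continuous_subtype_val (p := (· ∈ U))))
  refine ⟨O, hO, fun x hx => ?_⟩
  have := congrArg (fun s => (⟨x, hx⟩ : U) ∈ s) e
  simpa using this.symm

/-- Transfers a local property from `X` to the ambient space, where it becomes vacuous off the image
of the model. -/
theorem _root_.IsLocalModel.eventually_iff (h : IsLocalModel H n U φ Ω) {x : X} (hx : x ∈ U)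
    {P : X → Prop} (hP : ∀ᶠ y in 𝓝 x, P y) : ∀ᶠ z in 𝓝 (φ x), ∀ y ∈ U, φ y = z → P y := by
  obtain ⟨V, hVP, hV, hxV⟩ := eventually_nhds_iff.1 hP
  obtain ⟨O, hO, e⟩ := h.exists_isOpen hV
  filter_upwards [hO.mem_nhds ((e x hx).1 hxV)] with z hz y hy hyz
  exact hVP y ((e y hy).2 (hyz ▸ hz))

theorem _root_.IsLocalModel.restrict (h : IsLocalModel H n U φ Ω) {V : Set X} (hV : IsOpen V) :
    ∃ O : Set (Fin n → ℂ), IsOpen O ∧ (∀ x ∈ U, x ∈ V ↔ φ x ∈ O) ∧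
      IsLocalModel H n (U ∩ V) φ (Ω ∩ O) := by
  obtain ⟨O, hO, e⟩ := h.exists_isOpen hV
  refine ⟨O, hO, e, ⟨h.isOpen_source.inter hV, h.isOpen_ambient.inter hO, ?_, ?_,
    fun x hx => h.hol_iff x hx.1⟩⟩
  · exact h.isEmbedding.comp (IsEmbedding.inclusion inter_subset_left)
  · obtain ⟨S, hS, hSa, hSe⟩ := h.image_analytic
    refine ⟨S, hS, fun g hg => (hSa g hg).mono inter_subset_left, ?_⟩
    ext z
    constructor
    · rintro ⟨x, ⟨hx, hxV⟩, rfl⟩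
      have h1 : φ x ∈ φ '' U := ⟨x, hx, rfl⟩
      rw [hSe] at h1
      exact ⟨⟨h1.1, (e x hx).1 hxV⟩, h1.2⟩
    · rintro ⟨⟨h1, h2⟩, h3⟩
      have h4 : z ∈ φ '' U := by rw [hSe]; exact ⟨h1, h3⟩
      obtain ⟨x, hx, rfl⟩ := h4
      exact ⟨x, ⟨hx, (e x hx).2 h2⟩, rfl⟩

/-- Change of the ambient coordinates of a local model. -/
theorem _root_.IsLocalModel.changeCoordinates (h : IsLocalModel H n U φ Ω) {m : ℕ}
    (e : OpenPartialHomeomorph (Fin n → ℂ) (Fin m → ℂ)) (hΩ : Ω ⊆ e.source)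
    (he : ∀ y ∈ e.source, AnalyticAt ℂ e y) (he' : ∀ y ∈ e.target, AnalyticAt ℂ e.symm y) :
    IsLocalModel H m U (fun x => e (φ x)) (e '' Ω) where
  isOpen_source := h.isOpen_source
  isOpen_ambient := e.isOpen_image_of_subset_source h.isOpen_ambient hΩ
  isEmbedding := by
    have e1 : IsEmbedding (fun x : U => (⟨φ x, hΩ (h.mem_ambient x.2)⟩ : e.source)) :=
      IsEmbedding.of_comp (g := Subtype.val) (h.isEmbedding.continuous.subtype_mk _)
        continuous_subtype_val h.isEmbedding
    exact (IsEmbedding.subtypeVal.comp e.toHomeomorphSourceTarget.isEmbedding).comp e1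
  image_analytic := by
    obtain ⟨S, hS, hSa, hSe⟩ := h.image_analytic
    refine ⟨(fun g z => g (e.symm z)) '' S, hS.image _, ?_, ?_⟩
    · rintro _ ⟨g, hg, rfl⟩ _ ⟨z, hz, rfl⟩
      refine AnalyticAt.fun_comp ?_ (he' _ (e.map_source (hΩ hz)))
      rw [e.left_inv (hΩ hz)]
      exact hSa g hg z hz
    · rw [show (fun x => e (φ x)) '' U = e '' (φ '' U) by rw [image_image], hSe]
      ext w
      constructor
      · rintro ⟨z, ⟨hz, hz'⟩, rfl⟩
        refine ⟨⟨z, hz, rfl⟩, ?_⟩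
        rintro _ ⟨g, hg, rfl⟩
        simpa only [e.left_inv (hΩ hz)] using hz' g hg
      · rintro ⟨⟨z, hz, rfl⟩, hw⟩
        refine ⟨z, ⟨hz, fun g hg => ?_⟩, rfl⟩
        simpa only [e.left_inv (hΩ hz)] using hw _ ⟨g, hg, rfl⟩
  hol_iff := by
    intro x hx u
    have hs := hΩ (h.mem_ambient hx)
    rw [h.hol_iff x hx]
    constructor
    · rintro ⟨G, hG, eG⟩
      refine ⟨fun z => G (e.symm z), AnalyticAt.fun_comp ?_ (he' _ (e.map_source hs)), ?_⟩
      · rwa [e.left_inv hs]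
      · filter_upwards [eG, h.isOpen_source.mem_nhds hx] with y hy hyU
        rw [hy, e.left_inv (hΩ (h.mem_ambient hyU))]
    · rintro ⟨G, hG, eG⟩
      exact ⟨fun z => G (e z), AnalyticAt.fun_comp hG (he _ hs), eG⟩

theorem analyticAt_cons_zero (w : Fin n → ℂ) :
    AnalyticAt ℂ (fun w : Fin n → ℂ => (Fin.cons 0 w : Fin (n + 1) → ℂ)) w := by
  rw [analyticAt_pi_iff]
  refine fun j => Fin.cases ?_ (fun j => ?_) j
  · simpa only [Fin.cons_zero] using analyticAt_const
  · simpa only [Fin.cons_succ] using AnalyticGerm.analyticAt_coord j w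

theorem analyticAt_tail (z : Fin (n + 1) → ℂ) :
    AnalyticAt ℂ (fun z : Fin (n + 1) → ℂ => (Fin.tail z : Fin n → ℂ)) z := by
  rw [analyticAt_pi_iff]
  exact fun j => AnalyticGerm.analyticAt_coord j.succ z

/-- A local model contained in a coordinate hyperplane is a local model in the hyperplane. -/
theorem _root_.IsLocalModel.dropCoordinate {φ : X → (Fin (n + 1) → ℂ)} {Ω : Set (Fin (n + 1) → ℂ)}
    (h : IsLocalModel H (n + 1) U φ Ω) (h0 : ∀ x ∈ U, φ x 0 = 0) :
    IsLocalModel H n U (fun x => Fin.tail (φ x)) {w | (Fin.cons 0 w : Fin (n + 1) → ℂ) ∈ Ω} := by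
  have hc : ∀ x ∈ U, (Fin.cons 0 (Fin.tail (φ x)) : Fin (n + 1) → ℂ) = φ x := fun x hx => by
    rw [← h0 x hx, Fin.cons_self_tail]
  have hcont : Continuous (fun w : Fin n → ℂ => (Fin.cons 0 w : Fin (n + 1) → ℂ)) :=
    continuous_iff_continuousAt.2 fun w => (analyticAt_cons_zero w).continuousAt
  have hcont' : Continuous (fun z : Fin (n + 1) → ℂ => (Fin.tail z : Fin n → ℂ)) :=
    continuous_iff_continuousAt.2 fun w => (analyticAt_tail w).continuousAt
  refine ⟨h.isOpen_source, h.isOpen_ambient.preimage hcont, ?_, ?_, ?_⟩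
  · refine IsEmbedding.of_comp (g := fun w : Fin n → ℂ => (Fin.cons 0 w : Fin (n + 1) → ℂ))
      (hcont'.comp h.isEmbedding.continuous) hcont ?_
    convert h.isEmbedding using 1
    funext x
    exact hc x x.2
  · obtain ⟨S, hS, hSa, hSe⟩ := h.image_analytic
    refine ⟨(fun g w => g (Fin.cons 0 w)) '' S, hS.image _, ?_, ?_⟩
    · rintro _ ⟨g, hg, rfl⟩ w hw
      exact AnalyticAt.fun_comp (hSa g hg _ hw) (analyticAt_cons_zero w)
    · ext w
      constructor
      · rintro ⟨x, hx, rfl⟩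
        have h1 : φ x ∈ φ '' U := ⟨x, hx, rfl⟩
        rw [hSe] at h1
        refine ⟨?_, ?_⟩
        · rw [mem_ofPred_eq, hc x hx]; exact h1.1
        · rintro _ ⟨g, hg, rfl⟩
          simpa only [hc x hx] using h1.2 g hg
      · rintro ⟨h1, h2⟩
        have h4 : (Fin.cons 0 w : Fin (n + 1) → ℂ) ∈ φ '' U := by
          rw [hSe]
          exact ⟨h1, fun g hg => h2 _ ⟨g, hg, rfl⟩⟩
        obtain ⟨x, hx, ex⟩ := h4
        exact ⟨x, hx, by simp only [ex, Fin.tail_cons]⟩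
  · intro x hx u
    rw [h.hol_iff x hx]
    constructor
    · rintro ⟨G, hG, eG⟩
      refine ⟨fun w => G (Fin.cons 0 w), AnalyticAt.fun_comp ?_ (analyticAt_cons_zero _), ?_⟩
      · rwa [hc x hx]
      · filter_upwards [eG, h.isOpen_source.mem_nhds hx] with y hy hyU
        rw [hy, hc y hyU]
    · rintro ⟨G, hG, eG⟩
      exact ⟨fun z => G (Fin.tail z), AnalyticAt.fun_comp hG (analyticAt_tail _), eG⟩

/-- If a function with non-zero derivative vanishes on a local model, then the embedding
dimension can be lowered. -/
theorem _root_.IsLocalModel.exists_smaller (h : IsLocalModel H n U φ Ω) {x : X} (hx : x ∈ U)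
    {G : (Fin n → ℂ) → ℂ} (hG : AnalyticAt ℂ G (φ x)) (h0 : ∀ᶠ y in 𝓝 x, G (φ y) = 0)
    (hd : fderiv ℂ G (φ x) ≠ 0) :
    ∃ (k : ℕ) (V : Set X) (ψ : X → (Fin k → ℂ)) (Θ : Set (Fin k → ℂ)),
      k < n ∧ x ∈ V ∧ V ⊆ U ∧ IsLocalModel H k V ψ Θ := by
  obtain ⟨k, e, rfl, hxe, he0, he, he'⟩ := AnalyticGerm.exists_straightening hG hd
  obtain ⟨W, hW0, hWo, hxW⟩ := eventually_nhds_iff.1 h0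
  have hV : IsOpen (U ∩ φ ⁻¹' e.source) :=
    h.continuousOn.isOpen_inter_preimage h.isOpen_source e.open_source
  obtain ⟨O, hO, hOU, hm⟩ := h.restrict (hV.inter hWo)
  -- The ambient open set is shrunk into the source of `e`, as the change of coordinates requires;
  -- the model itself already lies there.
  obtain ⟨O', hO', hOU', hm'⟩ : ∃ O' : Set (Fin (k + 1) → ℂ), IsOpen O' ∧ O' ⊆ e.source ∧
      IsLocalModel H (k + 1) (U ∩ ((U ∩ φ ⁻¹' e.source) ∩ W)) φ O' := by
    refine ⟨Ω ∩ O ∩ e.source, hm.isOpen_ambient.inter e.open_source, inter_subset_right,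
      ⟨hm.isOpen_source, hm.isOpen_ambient.inter e.open_source, hm.isEmbedding, ?_, hm.hol_iff⟩⟩
    obtain ⟨S, hS, hSa, hSe⟩ := hm.image_analytic
    refine ⟨S, hS, fun g hg => (hSa g hg).mono inter_subset_left, ?_⟩
    have : φ '' (U ∩ ((U ∩ φ ⁻¹' e.source) ∩ W)) ⊆ e.source := by
      rintro _ ⟨y, hy, rfl⟩
      exact hy.2.1.2
    rw [← inter_eq_left.2 this, hSe]
    ext z
    simp only [mem_inter_iff, mem_ofPred_eq]
    tauto
  have hm2 := hm'.changeCoordinates e hOU' he he'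
  refine ⟨k, U ∩ ((U ∩ φ ⁻¹' e.source) ∩ W), _, _, Nat.lt_succ_self k, ⟨hx, ⟨hx, hxe⟩, hxW⟩, inter_subset_left,
    hm2.dropCoordinate fun y hy => ?_⟩
  rw [he0, hW0 y hy.2.2]

end LocalModels

/-! ### Holomorphic germs and coordinate charts -/

section Germs

variable {X : Type*} [TopologicalSpace X] [ComplexSpace X] {x : X}

theorem HolAt.congr {u v : X → ℂ} (hu : HolAt u x) (h : v =ᶠ[𝓝 x] u) : HolAt v x := by
  obtain ⟨n, U, φ, Ω, hx, hm⟩ := exists_localModel x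
  obtain ⟨G, hG, e⟩ := (hm.hol_iff x hx u).1 hu
  exact (hm.hol_iff x hx v).2 ⟨G, hG, h.trans e⟩

theorem HolAt.continuousAt {u : X → ℂ} (hu : HolAt u x) : ContinuousAt u x := by
  obtain ⟨n, U, φ, Ω, hx, hm⟩ := exists_localModel x
  obtain ⟨G, hG, e⟩ := (hm.hol_iff x hx u).1 hu
  exact ContinuousAt.congr (ContinuousAt.comp (f := φ) hG.continuousAt (hm.continuousAt hx)) e.symm

theorem HolAt.eventually {u : X → ℂ} (hu : HolAt u x) : ∀ᶠ y in 𝓝 x, HolAt u y := by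
  obtain ⟨n, U, φ, Ω, hx, hm⟩ := exists_localModel x
  obtain ⟨G, hG, e⟩ := (hm.hol_iff x hx u).1 hu
  filter_upwards [hm.isOpen_source.mem_nhds hx, e.eventually_nhds,
    (hm.continuousAt hx).eventually hG.eventually_analyticAt] with y hy h1 h2
  exact (hm.hol_iff y hy u).2 ⟨G, h2, h1⟩

theorem HolAt.analytic_comp {m : ℕ} {u : X → Fin m → ℂ} (hu : ∀ i, HolAt (fun y => u y i) x)
    {G : (Fin m → ℂ) → ℂ} (hG : AnalyticAt ℂ G (u x)) : HolAt (fun y => G (u y)) x := by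
  obtain ⟨n, U, φ, Ω, hx, hm⟩ := exists_localModel x
  choose K hK e using fun i => (hm.hol_iff x hx _).1 (hu i)
  have e0 : (fun i => K i (φ x)) = u x := by
    funext i; exact (e i).self_of_nhds.symm
  refine (hm.hol_iff x hx _).2 ⟨fun z => G fun i => K i z, ?_, ?_⟩
  · exact AnalyticAt.fun_comp (by rwa [e0]) (analyticAt_pi_iff.2 hK)
  · filter_upwards [eventually_all.2 e] with y hy
    congr 1
    funext i
    exact hy i

theorem HolAt.pow {u : X → ℂ} (hu : HolAt u x) (k : ℕ) : HolAt (fun y => u y ^ k) x := by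
  induction k with
  | zero => simpa using holAt_const 1 x
  | succ k ih => simpa only [pow_succ] using ih.mul hu

variable {n : ℕ} {U : Set X} {φ : X → (Fin n → ℂ)} {Ω : Set (Fin n → ℂ)}

theorem _root_.IsLocalModel.holAt_comp (h : IsLocalModel HolAt n U φ Ω) (hx : x ∈ U)
    {G : (Fin n → ℂ) → ℂ} (hG : AnalyticAt ℂ G (φ x)) : HolAt (fun y => G (φ y)) x :=
  (h.hol_iff x hx _).2 ⟨G, hG, EventuallyEq.rfl⟩

theorem _root_.IsLocalModel.holAt_coord (h : IsLocalModel HolAt n U φ Ω) (hx : x ∈ U) (i : Fin n) :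
    HolAt (fun y => φ y i) x :=
  h.holAt_comp hx (AnalyticGerm.analyticAt_coord i _)

theorem _root_.IsLocalModel.isCoordinates (h : IsLocalModel HolAt n U φ Ω)
    (ho : IsOpen (φ '' U)) : IsCoordinates n U φ :=
  ⟨h.isOpen_source, ho, h.isEmbedding, ⟨∅, finite_empty, by simp, by ext; simp⟩, h.hol_iff⟩

theorem IsCoordinates.isOpen_image (h : IsCoordinates n U φ) {V : Set X} (hV : IsOpen V) :
    IsOpen (φ '' (U ∩ V)) := by
  obtain ⟨O, hO, e⟩ := h.exists_isOpen hV
  have : φ '' (U ∩ V) = φ '' U ∩ O := by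
    ext z
    constructor
    · rintro ⟨x, ⟨hx, hxV⟩, rfl⟩
      exact ⟨⟨x, hx, rfl⟩, (e x hx).1 hxV⟩
    · rintro ⟨⟨x, hx, rfl⟩, h2⟩
      exact ⟨x, ⟨hx, (e x hx).2 h2⟩, rfl⟩
  rw [this]
  exact h.isOpen_ambient.inter hO

theorem IsCoordinates.restrict (h : IsCoordinates n U φ) {V : Set X} (hV : IsOpen V) :
    IsCoordinates n (U ∩ V) φ := by
  obtain ⟨O, hO, e, hm⟩ := IsLocalModel.restrict h hV
  exact hm.isCoordinates (h.isOpen_image hV)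

/-- This is how regularity is detected: if the image fills a neighbourhood of the point, restricting
to the preimage of its interior makes the image open, and no equations are left. -/
theorem _root_.IsLocalModel.isCoordinates_of_mem_nhds (h : IsLocalModel HolAt n U φ Ω)
    (hx : x ∈ U) (hn : φ '' U ∈ 𝓝 (φ x)) :
    ∃ V ⊆ U, x ∈ V ∧ IsCoordinates n V φ := by
  have hV : IsOpen (U ∩ φ ⁻¹' interior (φ '' U)) :=
    h.continuousOn.isOpen_inter_preimage h.isOpen_source isOpen_interior
  obtain ⟨O, hO, e, hm⟩ := h.restrict hV
  refine ⟨U ∩ (U ∩ φ ⁻¹' interior (φ '' U)), inter_subset_left, ⟨hx, hx, mem_interior_iff_mem_nhds.2 hn⟩, hm.isCoordinates ?_⟩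
  have : φ '' (U ∩ (U ∩ φ ⁻¹' interior (φ '' U))) = interior (φ '' U) := by
    ext z
    constructor
    · rintro ⟨y, hy, rfl⟩
      exact hy.2.2
    · intro hz
      obtain ⟨y, hy, rfl⟩ := interior_subset hz
      exact ⟨y, ⟨hy, hy, hz⟩, rfl⟩
  rw [this]
  exact isOpen_interior

theorem IsCoordinates.image_mem_nhds (h : IsCoordinates n U φ) (hx : x ∈ U) : φ '' U ∈ 𝓝 (φ x) :=
  h.isOpen_ambient.mem_nhds ⟨x, hx, rfl⟩

theorem IsCoordinates.eventually_iff (h : IsCoordinates n U φ) (hx : x ∈ U)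
    {P : (Fin n → ℂ) → Prop} : (∀ᶠ y in 𝓝 x, P (φ y)) ↔ ∀ᶠ z in 𝓝 (φ x), P z := by
  refine ⟨fun hP => ?_, fun hP => (IsLocalModel.continuousAt h hx).eventually hP⟩
  filter_upwards [IsLocalModel.eventually_iff h hx hP, h.image_mem_nhds hx] with z h1 ⟨y, hy, h2⟩
  exact h2 ▸ h1 y hy h2

/-- A function with non-zero derivative can be taken as the first coordinate. -/
theorem IsCoordinates.exists_straightening (h : IsCoordinates n U φ) (hx : x ∈ U)
    {G : (Fin n → ℂ) → ℂ} (hG : AnalyticAt ℂ G (φ x)) (hd : fderiv ℂ G (φ x) ≠ 0) :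
    ∃ (k : ℕ) (V : Set X) (ψ : X → (Fin (k + 1) → ℂ)), x ∈ V ∧ V ⊆ U ∧
      IsCoordinates (k + 1) V ψ ∧ ∀ y, ψ y 0 = G (φ y) := by
  obtain ⟨k, e, rfl, hxe, he0, he, he'⟩ := AnalyticGerm.exists_straightening hG hd
  have hV : IsOpen (U ∩ φ ⁻¹' e.source) :=
    (IsLocalModel.continuousOn h).isOpen_inter_preimage h.isOpen_source e.open_source
  have hm := h.restrict hV
  have hs : φ '' (U ∩ (U ∩ φ ⁻¹' e.source)) ⊆ e.source := by
    rintro _ ⟨y, hy, rfl⟩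
    exact hy.2.2
  have hm2 := IsLocalModel.changeCoordinates hm e hs he he'
  refine ⟨k, U ∩ (U ∩ φ ⁻¹' e.source), fun y => e (φ y), ⟨hx, hx, hxe⟩, inter_subset_left, hm2.isCoordinates ?_,
    fun y => he0 _⟩
  have := hm2.isOpen_ambient
  rwa [image_image] at this

end Germs

end ComplexSpace

namespace ComplexSpace

/-! ### Density of regular points and minimal local models -/

section Density

variable {X : Type*} [TopologicalSpace X] [ComplexSpace X]

theorem analyticAt_fderiv_apply {E : Type*} [NormedAddCommGroup E] [NormedSpace ℂ E]
    {G : E → ℂ} {z : E} (hG : AnalyticAt ℂ G z) (v : E) :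
    AnalyticAt ℂ (fun y => fderiv ℂ G y v) z :=
  ((ContinuousLinearMap.apply ℂ ℂ v).analyticAt _).fun_comp hG.fderiv

/-- The regular points of a reduced complex space are dense. -/
theorem dense_regularLocus : Dense (regularLocus X) := by
  classical
  rw [dense_iff_inter_open]
  rintro O hO ⟨p₀, hp₀⟩
  -- The embedding dimension is minimized over all local models inside `O`, with no base point
  -- fixed, so that minimality applies at every point of the chosen model.
  have hex : ∃ n : ℕ, ∃ (U : Set X) (φ : X → (Fin n → ℂ)) (Ω : Set (Fin n → ℂ)),
      U ⊆ O ∧ U.Nonempty ∧ IsLocalModel HolAt n U φ Ω := by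
    obtain ⟨n, U, φ, Ω, hU, hm⟩ := exists_localModel p₀
    obtain ⟨O', -, -, hm'⟩ := hm.restrict hO
    exact ⟨n, _, _, _, inter_subset_right, ⟨p₀, hU, hp₀⟩, hm'⟩
  obtain ⟨U, φ, Ω, hUO, ⟨p, hp⟩, hm⟩ := Nat.find_spec hex
  -- By minimality, functions vanishing on the model have zero derivative on it, so `C` is stable
  -- under derivatives. The equations of the model therefore vanish near `φ p`, and the image is a
  -- neighbourhood.
  set C : Set ((Fin (Nat.find hex) → ℂ) → ℂ) := {G | ∀ x ∈ U, AnalyticAt ℂ G (φ x) ∧ G (φ x) = 0} with hC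
  have hCd : ∀ G ∈ C, ∀ v, (fun y => fderiv ℂ G y v) ∈ C := by
    intro G hG v x hx
    refine ⟨analyticAt_fderiv_apply (hG x hx).1 v, ?_⟩
    have : fderiv ℂ G (φ x) = 0 := by
      by_contra hd
      obtain ⟨k, V, ψ, Θ, hk, hxV, hVU, hm'⟩ := hm.exists_smaller hx (hG x hx).1
        (by filter_upwards [hm.isOpen_source.mem_nhds hx] with y hy using (hG y hy).2) hd
      exact Nat.find_min hex hk ⟨V, ψ, Θ, hVU.trans hUO, ⟨x, hxV⟩, hm'⟩
    simp [this]
  obtain ⟨S, hS, hSa, hSe⟩ := hm.image_analytic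
  have hSC : ∀ g ∈ S, g ∈ C := fun g hg x hx => by
    have : φ x ∈ φ '' U := ⟨x, hx, rfl⟩
    rw [hSe] at this
    exact ⟨hSa g hg _ this.1, this.2 g hg⟩
  have hn : φ '' U ∈ 𝓝 (φ p) := by
    rw [hSe]
    filter_upwards [hm.isOpen_ambient.mem_nhds (hm.mem_ambient hp), (eventually_all_finite hS).2
      fun g hg => AnalyticGerm.eventually_eq_zero_of_derivatives_vanish C (fun G hG => hG p hp) hCd
        (hSC g hg)] with z h1 h2
    exact ⟨h1, h2⟩
  obtain ⟨V, hV, hpV, hc⟩ := hm.isCoordinates_of_mem_nhds hp hn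
  exact ⟨p, hUO hp, _, V, φ, hpV, hc⟩

/-- A local model at `x` of minimal embedding dimension: the functions vanishing on it have
vanishing derivative at `x`. -/
theorem exists_minimal_localModel (x : X) :
    ∃ (n : ℕ) (U : Set X) (φ : X → (Fin n → ℂ)) (Ω : Set (Fin n → ℂ)), x ∈ U ∧
      IsLocalModel HolAt n U φ Ω ∧ ∀ G : (Fin n → ℂ) → ℂ, AnalyticAt ℂ G (φ x) →
        (∀ᶠ y in 𝓝 x, G (φ y) = 0) → fderiv ℂ G (φ x) = 0 := by
  classical
  have hex : ∃ n : ℕ, ∃ (U : Set X) (φ : X → (Fin n → ℂ)) (Ω : Set (Fin n → ℂ)),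
      x ∈ U ∧ IsLocalModel HolAt n U φ Ω := exists_localModel x
  obtain ⟨U, φ, Ω, hx, hm⟩ := Nat.find_spec hex
  refine ⟨_, U, φ, Ω, hx, hm, fun G hG h0 => ?_⟩
  by_contra hd
  obtain ⟨k, V, ψ, Θ, hk, hxV, -, hm'⟩ := hm.exists_smaller hx hG h0 hd
  exact Nat.find_min hex hk ⟨V, ψ, Θ, hxV, hm'⟩

end Density

/-! ### Regular points of products -/

section Product

/-- The inclusion of the first factor of `ℂⁿ × ℂᵐ = ℂⁿ⁺ᵐ`. -/
noncomputable def appendLeft (n m : ℕ) : (Fin n → ℂ) →L[ℂ] (Fin (n + m) → ℂ) :=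
  LinearMap.toContinuousLinearMap
    { toFun := fun a => Fin.append a 0
      map_add' := fun a b => by
        funext i; refine Fin.addCases (fun i => ?_) (fun i => ?_) i <;> simp
      map_smul' := fun c a => by
        funext i; refine Fin.addCases (fun i => ?_) (fun i => ?_) i <;> simp }

/-- The inclusion of the second factor of `ℂⁿ × ℂᵐ = ℂⁿ⁺ᵐ`. -/
noncomputable def appendRight (n m : ℕ) : (Fin m → ℂ) →L[ℂ] (Fin (n + m) → ℂ) :=
  LinearMap.toContinuousLinearMap
    { toFun := fun a => Fin.append 0 a
      map_add' := fun a b => by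
        funext i; refine Fin.addCases (fun i => ?_) (fun i => ?_) i <;> simp
      map_smul' := fun c a => by
        funext i; refine Fin.addCases (fun i => ?_) (fun i => ?_) i <;> simp }

theorem append_eq {n m : ℕ} (a : Fin n → ℂ) (b : Fin m → ℂ) :
    (Fin.append a b : Fin (n + m) → ℂ) = appendLeft n m a + appendRight n m b := by
  funext i
  refine Fin.addCases (fun i => ?_) (fun i => ?_) i <;> simp [appendLeft, appendRight]

theorem hasFDerivAt_append_left {n m : ℕ} (a : Fin n → ℂ) (b : Fin m → ℂ) :
    HasFDerivAt (fun z : Fin n → ℂ => (Fin.append z b : Fin (n + m) → ℂ)) (appendLeft n m) a := by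
  simp only [append_eq]
  exact (appendLeft n m).hasFDerivAt.add_const _

theorem hasFDerivAt_append_right {n m : ℕ} (a : Fin n → ℂ) (b : Fin m → ℂ) :
    HasFDerivAt (fun z : Fin m → ℂ => (Fin.append a z : Fin (n + m) → ℂ)) (appendRight n m) b := by
  simp only [append_eq]
  exact (appendRight n m).hasFDerivAt.const_add _

theorem analyticAt_append_left {n m : ℕ} (a : Fin n → ℂ) (b : Fin m → ℂ) :
    AnalyticAt ℂ (fun z : Fin n → ℂ => (Fin.append z b : Fin (n + m) → ℂ)) a := by
  simp only [append_eq]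
  exact ((appendLeft n m).analyticAt _).add analyticAt_const

theorem analyticAt_append_right {n m : ℕ} (a : Fin n → ℂ) (b : Fin m → ℂ) :
    AnalyticAt ℂ (fun z : Fin m → ℂ => (Fin.append a z : Fin (n + m) → ℂ)) b := by
  simp only [append_eq]
  exact analyticAt_const.add ((appendRight n m).analyticAt _)

variable {X : Type*} [TopologicalSpace X] [ComplexSpace X]
  {Y : Type*} [TopologicalSpace Y] [ComplexSpace Y]

theorem _root_.IsLocalModel.exists_map {n m : ℕ} {U : Set X} {φ : X → (Fin n → ℂ)}
    {Ω : Set (Fin n → ℂ)} (h : IsLocalModel HolAt n U φ Ω) {x : X} (hx : x ∈ U)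
    {u : X → (Fin m → ℂ)} (hu : ∀ i, HolAt (fun y => u y i) x) :
    ∃ K : (Fin n → ℂ) → (Fin m → ℂ), AnalyticAt ℂ K (φ x) ∧ ∀ᶠ y in 𝓝 x, u y = K (φ y) := by
  choose K hK e using fun i => (h.hol_iff x hx _).1 (hu i)
  refine ⟨fun z i => K i z, analyticAt_pi_iff.2 hK, ?_⟩
  filter_upwards [eventually_all.2 e] with y hy
  funext i
  exact hy i

/-- If a point of a product is regular, then so are its components. -/
theorem mem_regularLocus_of_prod {x₀ : X} {y₀ : Y} (h : (x₀, y₀) ∈ regularLocus (X × Y)) :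
    x₀ ∈ regularLocus X ∧ y₀ ∈ regularLocus Y := by
  obtain ⟨N, W, Φ, hW, hΦ⟩ := h
  obtain ⟨n, U, φ, Ω, hx, hm, hmin⟩ := exists_minimal_localModel x₀
  obtain ⟨m, V, ψ, Θ, hy, hm', hmin'⟩ := exists_minimal_localModel y₀
  have hp : IsLocalModel HolAt (n + m) (U ×ˢ V) (fun p => Fin.append (φ p.1) (ψ p.2))
    {z | splitFst z ∈ Ω ∧ splitSnd z ∈ Θ} := IsLocalModel.prod hm hm'
  set χ : X × Y → (Fin (n + m) → ℂ) := fun p => Fin.append (φ p.1) (ψ p.2) with hχ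
  have hxy : (x₀, y₀) ∈ U ×ˢ V := ⟨hx, hy⟩
  obtain ⟨K, hK, eK⟩ := hp.exists_map hxy fun i => IsLocalModel.holAt_coord hΦ hW i
  obtain ⟨J, hJ, eJ⟩ := IsLocalModel.exists_map hΦ hW fun i => hp.holAt_coord hxy i
  have eK0 : Φ (x₀, y₀) = K (χ (x₀, y₀)) := eK.self_of_nhds
  set a := φ x₀
  set b := ψ y₀
  have hχ0 : χ (x₀, y₀) = Fin.append a b := rfl
  have hJ' : AnalyticAt ℂ J (K (χ (x₀, y₀))) := eK0 ▸ hJ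
  -- `K` and `J` extend the transition maps between `χ` and the chart `Φ`, so this difference
  -- vanishes on the image of `χ`. Minimality of the two models kills its derivative along each
  -- factor, hence altogether.
  have hT : AnalyticAt ℂ (fun w => w - J (K w)) (χ (x₀, y₀)) :=
    analyticAt_id.sub (hJ'.fun_comp hK)
  have hT0 : ∀ᶠ p in 𝓝 (x₀, y₀), χ p - J (K (χ p)) = 0 := by
    filter_upwards [eK, eJ] with p h1 h2
    rw [← h1, ← h2, sub_self]
  set B := fderiv ℂ (fun w => w - J (K w)) (χ (x₀, y₀)) with hB
  have hTj : ∀ j, AnalyticAt ℂ (fun w => (w - J (K w)) j) (Fin.append a b) := fun j =>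
    (analyticAt_pi_iff.1 (hχ0 ▸ hT)) j
  have hBj : ∀ j, HasFDerivAt (fun w => (w - J (K w)) j)
      ((ContinuousLinearMap.proj j).comp B) (Fin.append a b) := fun j =>
    (hasFDerivAt_pi'.1 (hχ0 ▸ hT).differentiableAt.hasFDerivAt) j
  have hl : ∀ v, B (appendLeft n m v) = 0 := by
    intro v
    funext j
    have e1 := hmin (fun z => (Fin.append z b - J (K (Fin.append z b))) j)
      (AnalyticAt.fun_comp (g := fun w => (w - J (K w)) j) (hTj j)
        (analyticAt_append_left a b)) (by
        have : Tendsto (fun x => (x, y₀)) (𝓝 x₀) (𝓝 (x₀, y₀)) := by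
          have : Continuous fun x : X => (x, y₀) := by fun_prop
          exact this.tendsto x₀
        filter_upwards [this.eventually hT0] with x h1
        exact congrFun h1 j)
    have e2 := ((hBj j).comp a (hasFDerivAt_append_left a b)).fderiv
    have := congrArg (fun L => L v) (e2.symm.trans e1)
    exact this
  have hr : ∀ v, B (appendRight n m v) = 0 := by
    intro v
    funext j
    have e1 := hmin' (fun z => (Fin.append a z - J (K (Fin.append a z))) j)
      (AnalyticAt.fun_comp (g := fun w => (w - J (K w)) j) (hTj j)
        (analyticAt_append_right a b)) (by
        have : Tendsto (fun y => (x₀, y)) (𝓝 y₀) (𝓝 (x₀, y₀)) := by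
          have : Continuous fun y : Y => (x₀, y) := by fun_prop
          exact this.tendsto y₀
        filter_upwards [this.eventually hT0] with x h1
        exact congrFun h1 j)
    have e2 := ((hBj j).comp b (hasFDerivAt_append_right a b)).fderiv
    have := congrArg (fun L => L v) (e2.symm.trans e1)
    exact this
  have hB0 : ∀ v, B v = 0 := fun v => by
    rw [← append_split v, append_eq, map_add, hl, hr, add_zero]
  have hBf : HasFDerivAt (fun w => w - J (K w)) (ContinuousLinearMap.id ℂ _ -
      (fderiv ℂ J (Φ (x₀, y₀))).comp (fderiv ℂ K (χ (x₀, y₀)))) (χ (x₀, y₀)) :=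
    (hasFDerivAt_id _).sub (HasFDerivAt.comp (g := J) _
      (by rw [← eK0]; exact hJ.differentiableAt.hasFDerivAt) hK.differentiableAt.hasFDerivAt)
  -- The derivative of `J ∘ K` is the identity, so `J` is a submersion and is open at this point.
  -- The image of `χ` is thus a neighbourhood, and so are its two slices.
  have hsurj : (fderiv ℂ J (Φ (x₀, y₀))).range = ⊤ := by
    rw [LinearMap.range_eq_top]
    intro v
    refine ⟨fderiv ℂ K (χ (x₀, y₀)) v, ?_⟩
    have := hB0 v
    rw [hB, hBf.fderiv] at this
    exact (sub_eq_zero.1 this).symm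
  have hmap := hJ.hasStrictFDerivAt.map_nhds_eq_of_surj hsurj
  have hJ0 : J (Φ (x₀, y₀)) = χ (x₀, y₀) := eJ.self_of_nhds.symm
  have him : ∀ᶠ w in 𝓝 (χ (x₀, y₀)), w ∈ χ '' (U ×ˢ V) := by
    rw [← hJ0, ← hmap, eventually_map, ← hΦ.eventually_iff hW]
    filter_upwards [eJ, hp.isOpen_source.mem_nhds hxy] with p h1 h2
    exact ⟨p, h2, h1⟩
  have hleft : φ '' U ∈ 𝓝 a := by
    filter_upwards [(analyticAt_append_left a b).continuousAt.eventually him]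
    rintro z ⟨p, hpU, e⟩
    refine ⟨p.1, hpU.1, ?_⟩
    have := congrArg splitFst e
    simpa only [hχ, splitFst_append] using this
  have hright : ψ '' V ∈ 𝓝 b := by
    filter_upwards [(analyticAt_append_right a b).continuousAt.eventually him]
    rintro z ⟨p, hpU, e⟩
    refine ⟨p.2, hpU.2, ?_⟩
    have := congrArg splitSnd e
    simpa only [hχ, splitSnd_append] using this
  obtain ⟨U', -, hU', hc⟩ := hm.isCoordinates_of_mem_nhds hx hleft
  obtain ⟨V', -, hV', hc'⟩ := hm'.isCoordinates_of_mem_nhds hy hright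
  exact ⟨⟨n, U', φ, hU', hc⟩, ⟨m, V', ψ, hV', hc'⟩⟩

end Product

/-! ### The identity theorem on irreducible spaces -/

section Identity

variable {X : Type*} [TopologicalSpace X] [ComplexSpace X]
  {Y : Type*} [TopologicalSpace Y] [ComplexSpace Y]

theorem IsHolomorphicMap.isAnalyticSubset_preimage {f : X → Y} (hf : IsHolomorphicMap f)
    {D : Set Y} (hD : IsAnalyticSubset D) : IsAnalyticSubset (f ⁻¹' D) := by
  intro x
  obtain ⟨U, S, hU, hx, hS, hSh, e⟩ := hD (f x)
  refine ⟨f ⁻¹' U, (fun u y => u (f y)) '' S, hU.preimage hf.continuous, hx, hS.image _, ?_, ?_⟩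
  · rintro _ ⟨u, hu, rfl⟩ y hy
    exact hf.holAt_comp y u (hSh u hu _ hy)
  · ext y
    have := congrArg (fun s => f y ∈ s) e
    simpa using this

/-- Unlike the local extensions `G`, the composite with the inverse chart is one function on the
whole image, so the identity theorem can be applied to it on a ball. -/
theorem IsCoordinates.analyticAt_of_holAt [Nonempty X] {n : ℕ} {U : Set X} {φ : X → (Fin n → ℂ)}
    (h : IsCoordinates n U φ) {x : X} (hx : x ∈ U) {u : X → ℂ} (hu : HolAt u x) :
    AnalyticAt ℂ (fun z => u (Function.invFunOn φ U z)) (φ x) := by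
  obtain ⟨G, hG, e⟩ := (h.hol_iff x hx u).1 hu
  refine hG.congr ?_
  filter_upwards [IsLocalModel.eventually_iff h hx e, h.image_mem_nhds hx] with z h1 h2
  exact (h1 _ (Function.invFunOn_mem h2) (Function.invFunOn_eq h2)).symm ▸
    congrArg G (Function.invFunOn_eq h2).symm

/-- On a complex space with connected regular locus, an analytic subset containing
a non-empty open set is the whole space. -/
theorem IsAnalyticSubset.eq_univ (hX : IsConnected (regularLocus X)) {A : Set X}
    (hA : IsAnalyticSubset A) {x₀ : X} (h0 : A ∈ 𝓝 x₀) : A = univ := by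
  have : Nonempty X := ⟨x₀⟩
  have hne : (regularLocus X ∩ interior A).Nonempty := by
    obtain ⟨x, h1, h2⟩ := dense_regularLocus.inter_open_nonempty _ isOpen_interior
      ⟨x₀, mem_interior_iff_mem_nhds.2 h0⟩
    exact ⟨x, h2, h1⟩
  -- By connectedness, it suffices that a regular point in the closure of `interior A` belongs to
  -- `interior A`: in a chart ball around it, the equations of `A` vanish near some point, hence on
  -- the whole ball.
  have hsub : regularLocus X ⊆ interior A := by
    refine hX.isPreconnected.subset_of_closure_inter_subset isOpen_interior hne ?_
    rintro x ⟨hxc, n, W, φ, hxW, hφ⟩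
    obtain ⟨U, S, hU, hxU, hS, hSh, e⟩ := hA x
    have hc := hφ.restrict hU
    have hx : x ∈ W ∩ U := ⟨hxW, hxU⟩
    obtain ⟨r, hr, hball⟩ := Metric.mem_nhds_iff.1 (hc.image_mem_nhds hx)
    have hN : (W ∩ U) ∩ φ ⁻¹' Metric.ball (φ x) r ∈ 𝓝 x :=
      inter_mem (hc.isOpen_source.mem_nhds hx)
        ((IsLocalModel.continuousAt hc hx) (Metric.ball_mem_nhds _ hr))
    obtain ⟨y, ⟨hyW, hyb⟩, hyA⟩ := mem_closure_iff_nhds.1 hxc _ hN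
    have hz : ∀ u ∈ S, ∀ x' ∈ W ∩ U, φ x' ∈ Metric.ball (φ x) r → u x' = 0 := by
      intro u hu x' hx' hx'b
      have hinv : ∀ t ∈ W ∩ U, Function.invFunOn φ (W ∩ U) (φ t) = t := fun t ht =>
        (IsLocalModel.injOn hc) (Function.invFunOn_mem ⟨t, ht, rfl⟩) ht
          (Function.invFunOn_eq ⟨t, ht, rfl⟩)
      have han : AnalyticOnNhd ℂ (fun z => u (Function.invFunOn φ (W ∩ U) z))
          (Metric.ball (φ x) r) := by
        intro z hz
        obtain ⟨t, ht, rfl⟩ := hball hz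
        exact hc.analyticAt_of_holAt ht (hSh u hu t ht.2)
      have hyz : (fun z => u (Function.invFunOn φ (W ∩ U) z)) =ᶠ[𝓝 (φ y)] 0 := by
        refine (hc.eventually_iff hyW).1 ?_
        filter_upwards [isOpen_interior.mem_nhds hyA, hc.isOpen_source.mem_nhds hyW] with t ht htW
        have : t ∈ A ∩ U := ⟨interior_subset ht, htW.2⟩
        rw [e] at this
        simpa only [hinv t htW, Pi.zero_apply] using this.2 u hu
      have := han.eqOn_zero_of_preconnected_of_eventuallyEq_zero
        (AnalyticGerm.isPreconnected_ball _ _) hyb hyz hx'b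
      simpa only [hinv x' hx', Pi.zero_apply] using this
    refine mem_interior_iff_mem_nhds.2 (mem_of_superset hN fun t ht => ?_)
    have : t ∈ {y | y ∈ U ∧ ∀ u ∈ S, u y = 0} := ⟨ht.1.2, fun u hu => hz u hu t ht.1 ht.2⟩
    rw [← e] at this
    exact this.1
  refine eq_univ_of_forall fun y => ?_
  obtain ⟨U, S, hU, hyU, hS, hSh, e⟩ := hA y
  -- Beyond the regular locus, continuity of the equations and density conclude.
  have : y ∈ {y | y ∈ U ∧ ∀ u ∈ S, u y = 0} := by
    refine ⟨hyU, fun u hu => ?_⟩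
    by_contra hne
    obtain ⟨t, ⟨h1, h2⟩, h3⟩ := mem_closure_iff_nhds.1 (dense_regularLocus y) _
      (inter_mem ((hSh u hu y hyU).continuousAt.eventually_ne hne) (hU.mem_nhds hyU))
    have : t ∈ A ∩ U := ⟨interior_subset (hsub h3), h2⟩
    rw [e] at this
    exact h1 (this.2 u hu)
  rw [← e] at this
  exact this.1

end Identity

end ComplexSpace

namespace ComplexSpace

/-! ### Order of vanishing along a smooth hypersurface -/

section Hypersurfaces

variable {X : Type*} [TopologicalSpace X] [ComplexSpace X] {n : ℕ} {U : Set X}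
  {φ : X → (Fin (n + 1) → ℂ)} {x : X}

/-- A holomorphic germ vanishing on the hypersurface `φ₀ = 0` is divisible by `φ₀`. -/
theorem IsCoordinates.exists_eq_mul (h : IsCoordinates (n + 1) U φ) (hx : x ∈ U)
    (hx0 : φ x 0 = 0) {u : X → ℂ} (hu : HolAt u x) (h0 : ∀ᶠ y in 𝓝 x, φ y 0 = 0 → u y = 0) :
    ∃ v : X → ℂ, HolAt v x ∧ ∀ᶠ y in 𝓝 x, u y = φ y 0 * v y := by
  obtain ⟨G, hG, e⟩ := (h.hol_iff x hx u).1 hu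
  have h0' : ∀ᶠ z in 𝓝 (φ x), z 0 = 0 → G z = 0 := by
    refine (h.eventually_iff hx).1 ?_
    filter_upwards [h0, e] with y h1 h2 h3
    rw [← h2, h1 h3]
  obtain ⟨Q, hQ, eQ⟩ := AnalyticGerm.exists_eq_mul_of_vanishing hG
    (ContinuousLinearMap.proj (R := ℂ) (φ := fun _ : Fin (n + 1) => ℂ) 0) (e := Pi.single 0 1)
    (by simp) (by simpa [hx0] using h0')
  refine ⟨_, IsLocalModel.holAt_comp h hx hQ, ?_⟩
  filter_upwards [e, (h.eventually_iff hx).2 eQ] with y h1 h2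
  rw [h1, h2]
  simp [hx0]

/-- If the product of two holomorphic germs vanishes on the hypersurface `φ₀ = 0`, then so does
one of the factors. -/
theorem IsCoordinates.eventually_eq_zero_or (h : IsCoordinates (n + 1) U φ) (hx : x ∈ U)
    (hx0 : φ x 0 = 0) {u v : X → ℂ} (hu : HolAt u x) (hv : HolAt v x)
    (huv : ∀ᶠ y in 𝓝 x, φ y 0 = 0 → u y * v y = 0) :
    (∀ᶠ y in 𝓝 x, φ y 0 = 0 → u y = 0) ∨ ∀ᶠ y in 𝓝 x, φ y 0 = 0 → v y = 0 := by
  obtain ⟨A, hA, eA⟩ := (h.hol_iff x hx u).1 hu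
  obtain ⟨B, hB, eB⟩ := (h.hol_iff x hx v).1 hv
  -- The hyperplane is parametrized by `Fin.cons 0`, which reduces the claim to the absence of zero
  -- divisors among germs in `n` variables.
  have hc : (Fin.cons 0 (Fin.tail (φ x)) : Fin (n + 1) → ℂ) = φ x := by
    rw [← hx0, Fin.cons_self_tail]
  have hcons := analyticAt_cons_zero (Fin.tail (φ x))
  have ht : Tendsto (fun w : Fin n → ℂ => (Fin.cons 0 w : Fin (n + 1) → ℂ))
      (𝓝 (Fin.tail (φ x))) (𝓝 (φ x)) := by
    simpa only [ContinuousAt, hc] using hcons.continuousAt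
  have back : ∀ {w : X → ℂ} {C : (Fin (n + 1) → ℂ) → ℂ}, (w =ᶠ[𝓝 x] fun y => C (φ y)) →
      (∀ᶠ t in 𝓝 (Fin.tail (φ x) : Fin n → ℂ), C (Fin.cons 0 t) = 0) →
      ∀ᶠ y in 𝓝 x, φ y 0 = 0 → w y = 0 := by
    intro w C e h0
    filter_upwards [e, (h.eventually_iff hx).2 ((analyticAt_tail (φ x)).continuousAt.eventually h0)]
      with y h1 h2 h3
    have h4 : (Fin.cons 0 (Fin.tail (φ y)) : Fin (n + 1) → ℂ) = φ y := by
      rw [← h3, Fin.cons_self_tail]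
    rw [h1, ← h4, h2]
  have hprod : ∀ᶠ z in 𝓝 (φ x), z 0 = 0 → A z * B z = 0 := by
    refine (h.eventually_iff hx).1 ?_
    filter_upwards [huv, eA, eB] with y h1 h2 h3 h4
    rw [← h2, ← h3, h1 h4]
  have hprod' : ∀ᶠ t in 𝓝 (Fin.tail (φ x) : Fin n → ℂ),
      A (Fin.cons 0 t) * B (Fin.cons 0 t) = 0 := by
    filter_upwards [ht.eventually hprod] with t h1 using h1 (Fin.cons_zero _ _)
  refine (AnalyticGerm.eventually_eq_zero_or (AnalyticAt.fun_comp (by rwa [hc]) hcons)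
    (AnalyticAt.fun_comp (by rwa [hc]) hcons) hprod').imp (back eA) (back eB)

/-- If `φ₀ ^ j * v` is divisible by a higher power of a function vanishing on `φ₀ = 0`, then `v`
vanishes on `φ₀ = 0`. -/
theorem IsCoordinates.eq_zero_of_pow_mul_eq (h : IsCoordinates (n + 1) U φ) (hx : x ∈ U)
    (hx0 : φ x 0 = 0) {v u w : X → ℂ} (hv : HolAt v x) (hu : HolAt u x) (hw : HolAt w x)
    (hw0 : ∀ᶠ y in 𝓝 x, φ y 0 = 0 → w y = 0) {j k : ℕ} (hjk : j < k)
    (e : ∀ᶠ y in 𝓝 x, φ y 0 ^ j * v y = u y * w y ^ k) : v x = 0 := by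
  obtain ⟨w', hw', ew⟩ := h.exists_eq_mul hx hx0 hw hw0
  obtain ⟨d, rfl⟩ := Nat.exists_eq_add_of_lt hjk
  have hφ0 : HolAt (fun y => φ y 0) x := IsLocalModel.holAt_coord h hx 0
  -- With `w = φ₀ w'` and `k = j + d + 1`, cancelling `φ₀ ^ j` should leave `v = u w' ^ k φ₀ ^ (d +
  -- 1)`, which is zero at `x`. This is the difference of the two sides.
  have hD : HolAt (fun y => v y + (-1) * ((u y * w' y ^ (j + d + 1)) * φ y 0 ^ (d + 1))) x :=
    hv.add ((holAt_const _ _).mul ((hu.mul (hw'.pow _)).mul (hφ0.pow _)))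
  obtain ⟨C, hC, eC⟩ := (h.hol_iff x hx _).1 hD
  have hz : ∀ᶠ z in 𝓝 (φ x), z 0 ^ j * C z = 0 := by
    refine (h.eventually_iff hx).1 ?_
    filter_upwards [e, ew, eC] with y h1 h2 h3
    rw [← h3, mul_add, h1, h2]
    ring
  rcases AnalyticGerm.eventually_eq_zero_or
    ((AnalyticGerm.analyticAt_coord 0 (φ x)).pow j) hC hz with h1 | h1
  · exfalso
    -- On the punctured line through `φ x` in the direction of the first coordinate, `z₀ ^ j` is
    -- non-zero.
    have ht : Tendsto (fun t : ℂ => φ x + t • (Pi.single 0 1 : Fin (n + 1) → ℂ)) (𝓝[≠] 0)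
        (𝓝 (φ x)) := by
      have := (AnalyticGerm.analyticAt_line (φ x) (Pi.single 0 1) 0).continuousAt.tendsto
      rw [zero_smul, add_zero] at this
      exact this.mono_left nhdsWithin_le_nhds
    obtain ⟨t, h2, h3⟩ := ((ht.eventually h1).and self_mem_nhdsWithin).exists
    simp [hx0] at h2
    exact h3 h2.1
  · have h2 := eC.self_of_nhds
    beta_reduce at h2
    rw [h1.self_of_nhds, hx0] at h2
    simpa using h2

end Hypersurfaces

/-! ### The orbifold condition on a single map -/

section Transversal

variable {X : Type*} [TopologicalSpace X] [ComplexSpace X]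
  {Y : Type*} [TopologicalSpace Y] [ComplexSpace Y]

theorem HolAt.slice {w : X × Y → ℂ} {x : X} {y : Y} (hw : HolAt w (x, y)) :
    HolAt (fun x' => w (x', y)) x := by
  obtain ⟨n, m, u, v, G, hu, hv, hG, e⟩ := hw
  have h1 : HolAt (fun x' => (fun z : Fin n → ℂ => G (z, fun j => v j y)) fun i => u i x') x :=
    HolAt.analytic_comp (u := fun x' i => u i x') hu
      (AnalyticAt.fun_comp (g := G) hG (analyticAt_id.prod analyticAt_const))
  have ht : Tendsto (fun x' => (x', y)) (𝓝 x) (𝓝 (x, y)) := by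
    have : Continuous fun x' : X => (x', y) := by fun_prop
    exact this.tendsto x
  exact h1.congr (ht.eventually e)

/-- At a point where `f⁻¹(D)` is the smooth hypersurface `χ₀ = 0`, the pull-back by an
orbifold morphism of a function vanishing on `D` vanishes to order at least
the multiplicity of `D`. -/
theorem IsOrbifoldMorphism.eq_zero_of_pow_mul {Δ : OrbifoldDivisor Y} {f : X → Y}
    (hf : IsOrbifoldMorphism (OrbifoldDivisor.trivial X) Δ f) {D : Set Y} (hD : IsPrimeDivisor D)
    {n : ℕ} {V : Set X} {χ : X → (Fin (n + 1) → ℂ)} (hχ : IsCoordinates (n + 1) V χ) {x : X}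
    (hx : x ∈ V) (hx0 : χ x 0 = 0) (hV : ∀ y ∈ V, y ∈ f ⁻¹' D ↔ χ y 0 = 0)
    {g : Y → ℂ} (hg : HolAt g (f x)) (hgD : ∀ᶠ y in 𝓝 (f x), y ∈ D → g y = 0)
    {v : X → ℂ} (hv : HolAt v x) {j k : ℕ} (hjk : j < k) (hk : (k : ℕ∞) ≤ Δ.mult D)
    (e : ∀ᶠ y in 𝓝 x, g (f y) = χ y 0 ^ j * v y) : v x = 0 := by
  have hxl : x ∈ hypersurfaceLocus (f ⁻¹' D) := ⟨(hV x hx).2 hx0, n, V, χ, hx, hχ, hV⟩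
  set E := closure (connectedComponentIn (hypersurfaceLocus (f ⁻¹' D)) x)
  have h1 := hf.mult_le D hD E ⟨x, hxl, rfl⟩
  have h2 : Δ.mult D ≤ pullbackMultiplicity f D E := by
    simpa only [OrbifoldDivisor.trivial, mul_one] using h1
  have h3 : pullbackMultiplicity f D E ≤ pullbackOrderAt f D x :=
    iInf₂_le x ⟨subset_closure (mem_connectedComponentIn hxl), hxl⟩
  -- `E` is the component through `x`, so its multiplicity bounds the order at `x` from below. Only
  -- some exponent `k' > j` is extracted from the supremum; this covers infinite multiplicity.
  have h4 : (j : ℕ∞) < pullbackOrderAt f D x :=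
    lt_of_lt_of_le (by exact_mod_cast hjk) (hk.trans (h2.trans h3))
  obtain ⟨k', h5⟩ := lt_iSup_iff.1 h4
  obtain ⟨h6, h7⟩ := lt_iSup_iff.1 h5
  obtain ⟨w, u, hw, hu, hw0, ew⟩ := h6 g hg hgD
  refine hχ.eq_zero_of_pow_mul_eq hx hx0 hv hu hw ?_ (by exact_mod_cast h7 : j < k') ?_
  · filter_upwards [hw0, hχ.isOpen_source.mem_nhds hx] with y h8 h9 h10
    exact h8 ((hV y h9).2 h10)
  · filter_upwards [e, ew] with y h8 h9
    rw [← h8, h9]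

end Transversal

/-! ### From the slices to the evaluation map -/

section Family

variable {X : Type*} [TopologicalSpace X] [ComplexSpace X]
  {Y : Type*} [TopologicalSpace Y] [ComplexSpace Y]
  {Δ : OrbifoldDivisor Y} {F : Set (HolMap X Y)} [ComplexSpace F]

/-- Near a point where `ev⁻¹(D)` is the smooth hypersurface `Φ₀ = 0`, the pull-back by the
evaluation map of a function vanishing on `D` vanishes along it to order at least the
multiplicity of `D`, as soon as it does so on the slices `X × {f}`. -/
theorem eventually_eq_zero_of_evalMap_eq (hX : IsConnected (regularLocus X))
    (hFΔ : ∀ f ∈ F, IsOrbifoldMorphism (OrbifoldDivisor.trivial X) Δ f.toFun)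
    (hev : IsHolomorphicMap (evalMap F)) {D : Set Y} (hD1 : Δ.mult D ≠ 1)
    {N : ℕ} {W : Set (X × F)} {Φ : X × F → (Fin (N + 1) → ℂ)} (hΦ : IsCoordinates (N + 1) W Φ)
    {p₀ : X × F} (hp : p₀ ∈ W) (hp0 : Φ p₀ 0 = 0) (hW : ∀ p ∈ W, p ∈ evalMap F ⁻¹' D ↔ Φ p 0 = 0)
    {g : Y → ℂ} (hg : HolAt g (evalMap F p₀))
    (hgD : ∀ᶠ y in 𝓝 (evalMap F p₀), y ∈ D → g y = 0)
    {v : X × F → ℂ} (hv : HolAt v p₀) {j k : ℕ} (hjk : j < k) (hk : (k : ℕ∞) ≤ Δ.mult D)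
    (e : ∀ᶠ p in 𝓝 p₀, g (evalMap F p) = Φ p 0 ^ j * v p) :
    ∀ᶠ p in 𝓝 p₀, Φ p 0 = 0 → v p = 0 := by
  obtain ⟨x₀, f₀⟩ := p₀
  have hD := Δ.isPrimeDivisor D hD1
  obtain ⟨⟨n, U, φ, hxU, hφ⟩, ⟨m, V, ψ, hfV, hψ⟩⟩ :=
    mem_regularLocus_of_prod (x₀ := x₀) (y₀ := f₀) ⟨N + 1, W, Φ, hp, hΦ⟩
  have hP := IsLocalModel.prod hφ hψ
  set χ : X × F → (Fin (n + m) → ℂ) := fun p => Fin.append (φ p.1) (ψ p.2) with hχ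
  have hxf : (x₀, f₀) ∈ U ×ˢ V := ⟨hxU, hfV⟩
  -- `s` is the equation `Φ₀` in product coordinates; its derivatives along `appendLeft` are the
  -- `X`-derivatives.
  obtain ⟨s, hs, es⟩ := (hP.hol_iff _ hxf _).1 (IsLocalModel.holAt_coord hΦ hp 0)
  have hslice : ∀ (x : X) (f : F), Tendsto (fun x' => (x', f)) (𝓝 x) (𝓝 (x, f)) := fun x f => by
    have : Continuous fun x' : X => (x', f) := by fun_prop
    exact this.tendsto x
  have hds : ∀ {p : X × F} (z : Fin n → ℂ), AnalyticAt ℂ s (Fin.append z (ψ p.2)) → ∀ d,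
      fderiv ℂ (fun z => s (Fin.append z (ψ p.2))) z d =
        fderiv ℂ s (Fin.append z (ψ p.2)) (appendLeft n m d) := fun {p} z hz d => by
    have := (hz.differentiableAt.hasFDerivAt.comp z (hasFDerivAt_append_left z (ψ p.2))).fderiv
    exact congrArg (fun L => L d) this
  have hc : ∀ d : Fin n → ℂ, HolAt (fun p => fderiv ℂ s (χ p) (appendLeft n m d)) (x₀, f₀) :=
    fun d => hP.holAt_comp hxf (analyticAt_fderiv_apply hs _)
  have key : ∀ d : Fin n → ℂ, ∀ᶠ p in 𝓝 (x₀, f₀), Φ p 0 = 0 →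
      v p * fderiv ℂ s (χ p) (appendLeft n m d) = 0 := by
    intro d
    have hev0 := hev.continuous.continuousAt (x := (x₀, f₀))
    filter_upwards [hΦ.isOpen_source.mem_nhds hp, hP.isOpen_source.mem_nhds hxf,
      hev0.eventually hg.eventually, hev0.eventually hgD.eventually_nhds, hv.eventually,
      e.eventually_nhds, (hP.continuousAt hxf).eventually hs.eventually_analyticAt,
      es.eventually_nhds] with p hpW hpU hgp hgDp hvp ep hsp esp hp0
    obtain ⟨x, f⟩ := p
    by_cases hd : fderiv ℂ s (χ (x, f)) (appendLeft n m d) = 0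
    · rw [hd, mul_zero]
    have hG : AnalyticAt ℂ (fun z => s (Fin.append z (ψ f))) (φ x) :=
      AnalyticAt.fun_comp (g := s) hsp (analyticAt_append_left (φ x) (ψ f))
    -- Where the `X`-derivative is non-zero, `Φ₀(·, f)` becomes the first coordinate of a chart of
    -- `X`, so `f⁻¹(D)` is a smooth hypersurface at `x` and the orbifold condition on `f` applies.
    obtain ⟨l, V', χ', hxV', -, hχ', e'⟩ := hφ.exists_straightening hpU.1 hG fun h0 => hd <| by
      rw [← hds (p := (x, f)) (φ x) hsp d, h0]
      rfl
    obtain ⟨O, hOs, hO, hxO⟩ := eventually_nhds_iff.1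
      ((hslice x f).eventually (esp.and (hΦ.isOpen_source.mem_nhds hpW)))
    have hx0 : χ' x 0 = 0 := by
      rw [e', ← hp0]
      exact (esp.self_of_nhds).symm
    have hv0 : v (x, f) = 0 := by
      refine (hFΔ f.1 f.2).eq_zero_of_pow_mul (v := fun x' => v (x', f)) hD (hχ'.restrict hO)
        ⟨hxV', hxO⟩ hx0 ?_ hgp hgDp hvp.slice hjk hk ?_
      · intro y hy
        have h1 := hOs y hy.2
        rw [e', ← show Φ (y, f) 0 = s (Fin.append (φ y) (ψ f)) from h1.1]
        exact hW (y, f) h1.2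
      · filter_upwards [(hslice x f).eventually ep, (hslice x f).eventually esp] with y h1 h2
        rw [e', ← show Φ (y, f) 0 = s (Fin.append (φ y) (ψ f)) from h2]
        exact h1
    rw [hv0, zero_mul]
  by_contra hne
  -- If `v` does not vanish on the hypersurface, irreducibility of its germ forces all
  -- `X`-derivatives of `Φ₀` to vanish there.
  have hall : ∀ d : Fin n → ℂ, ∀ᶠ p in 𝓝 (x₀, f₀), Φ p 0 = 0 →
      fderiv ℂ s (χ p) (appendLeft n m d) = 0 := fun d =>
    (hΦ.eventually_eq_zero_or hp hp0 hv (hc d) (key d)).resolve_left hne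
  have hG : AnalyticAt ℂ (fun z => s (Fin.append z (ψ f₀))) (φ x₀) :=
    AnalyticAt.fun_comp (g := s) hs (analyticAt_append_left (φ x₀) (ψ f₀))
  -- These derivatives are then divisible by `Φ₀`; restricted to the slice of `f₀`, this is a linear
  -- differential equation for `Φ₀(·, f₀)`.
  have hG0 := AnalyticGerm.eventually_eq_zero_of_fderiv_eq_mul hG
    (es.self_of_nhds.symm.trans hp0) fun d => by
      obtain ⟨q, hq, eq⟩ := hΦ.exists_eq_mul hp hp0 (hc d) (hall d)
      obtain ⟨Q, hQ, eQ⟩ := (hP.hol_iff _ hxf _).1 hq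
      refine ⟨fun z => Q (Fin.append z (ψ f₀)),
        AnalyticAt.fun_comp (g := Q) hQ (analyticAt_append_left (φ x₀) (ψ f₀)), ?_⟩
      refine (hφ.eventually_iff hxU).1 ?_
      filter_upwards [(hslice x₀ f₀).eventually eq, (hslice x₀ f₀).eventually eQ,
        (hslice x₀ f₀).eventually es, (hslice x₀ f₀).eventually
          ((hP.continuousAt hxf).eventually hs.eventually_analyticAt)] with x h1 h2 h3 h4
      rw [hds (p := (x, f₀)) (φ x) h4 d]
      refine h1.trans ?_
      rw [h2, h3]
  have hA : f₀.1.toFun ⁻¹' D ∈ 𝓝 x₀ := by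
    filter_upwards [(hφ.eventually_iff hxU).2 hG0, (hslice x₀ f₀).eventually es,
      (hslice x₀ f₀).eventually (hΦ.isOpen_source.mem_nhds hp)] with x h1 h2 h3
    exact (hW (x, f₀) h3).2 (h2.trans h1)
  have huniv := (f₀.1.isHolomorphicMap.isAnalyticSubset_preimage hD.analytic).eq_univ hX hA
  refine (hFΔ f₀.1 f₀.2).not_subset_support ?_
  rintro _ ⟨x, rfl⟩
  have : x ∈ f₀.1.toFun ⁻¹' D := huniv ▸ mem_univ x
  exact ⟨D, hD1, this⟩

/-- At each smooth point of `ev⁻¹(D)`, factors `Φ₀` are split off `g ∘ ev` one at a time. Testing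
every natural number `k` below the multiplicity of `D` also handles the value `∞`. -/
theorem mult_le_pullbackMultiplicity_evalMap (hX : IsConnected (regularLocus X))
    (hFΔ : ∀ f ∈ F, IsOrbifoldMorphism (OrbifoldDivisor.trivial X) Δ f.toFun)
    (hev : IsHolomorphicMap (evalMap F)) (D : Set Y) (E : Set (X × F)) :
    Δ.mult D ≤ pullbackMultiplicity (evalMap F) D E := by
  refine le_iInf₂ fun p₀ hp₀ => ENat.forall_natCast_le_iff_le.1 fun k hk => ?_
  refine le_iSup₂_of_le k (fun g hg hgD => ?_) le_rfl
  obtain ⟨-, hpD, N, W, Φ, hp, hΦ, hW⟩ := hp₀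
  have hp0 : Φ p₀ 0 = 0 := (hW p₀ hp).1 hpD
  have key : ∀ j ≤ k, ∃ v : X × F → ℂ, HolAt v p₀ ∧
      ∀ᶠ p in 𝓝 p₀, g (evalMap F p) = Φ p 0 ^ j * v p := by
    intro j
    induction j with
    | zero => exact fun _ => ⟨_, hev.holAt_comp p₀ g hg, Eventually.of_forall fun p => by simp⟩
    | succ j ih =>
      intro hj
      obtain ⟨v, hv, e⟩ := ih (Nat.le_of_succ_le hj)
      have hv0 : ∀ᶠ p in 𝓝 p₀, Φ p 0 = 0 → v p = 0 := by
        -- The first factor comes from `g = 0` on `D` alone. This case is kept apart because a `D`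
        -- of multiplicity one need not lie in the support; for `j ≥ 1`, `k ≥ 2` excludes
        -- multiplicity one.
        rcases Nat.eq_zero_or_pos j with rfl | hj0
        · filter_upwards [e, hev.continuous.continuousAt.eventually hgD,
            hΦ.isOpen_source.mem_nhds hp] with p h1 h2 h3 h4
          rw [pow_zero, one_mul] at h1
          rw [← h1, h2 ((hW p h3).2 h4)]
        · have hD1 : Δ.mult D ≠ 1 := fun h1 => by
            rw [h1] at hk
            have : k ≤ 1 := by exact_mod_cast hk
            omega
          exact eventually_eq_zero_of_evalMap_eq hX hFΔ hev hD1 hΦ hp hp0 hW hg hgD hv hj hk e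
      obtain ⟨v', hv', e'⟩ := hΦ.exists_eq_mul hp hp0 hv hv0
      refine ⟨v', hv', ?_⟩
      filter_upwards [e, e'] with p h1 h2
      rw [h1, h2, pow_succ, mul_assoc]
  obtain ⟨v, hv, e⟩ := key k le_rfl
  refine ⟨fun p => Φ p 0, v, IsLocalModel.holAt_coord hΦ hp 0, hv, ?_, ?_⟩
  · filter_upwards [hΦ.isOpen_source.mem_nhds hp] with p h1 h2 using (hW p h1).1 h2
  · filter_upwards [e] with p h1
    rw [h1, mul_comm]

end Family

end ComplexSpace

theorem mainTheorem10 {X : Type*} [TopologicalSpace X] [ComplexSpace X]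
    {Y : Type*} [TopologicalSpace Y] [ComplexSpace Y]
    (hX : ComplexSpace.IsNormalVariety X) (hY : ComplexSpace.IsNormalVariety Y)
    (Δ : ComplexSpace.OrbifoldDivisor Y)
    (F : Set (ComplexSpace.HolMap X Y))
    (hFΔ : ∀ f ∈ F, ComplexSpace.IsOrbifoldMorphism
      (ComplexSpace.OrbifoldDivisor.trivial X) Δ f.toFun)
    (hFlc : IsLocallyClosed F)
    [ComplexSpace F] (hF : ComplexSpace.IsNormalVariety F)
    (hev : ComplexSpace.IsHolomorphicMap (ComplexSpace.evalMap F)) :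
    ComplexSpace.IsOrbifoldMorphism (ComplexSpace.OrbifoldDivisor.trivial (X × F)) Δ
        (ComplexSpace.evalMap F) ∧
      ∀ D : Set Y, Δ.mult D ≠ 1 →
        ∀ E : Set (X × F), ComplexSpace.IsDivisorComponent (ComplexSpace.evalMap F ⁻¹' D) E →
          Δ.mult D ≤ ComplexSpace.pullbackMultiplicity (ComplexSpace.evalMap F) D E := by
  have key := ComplexSpace.mult_le_pullbackMultiplicity_evalMap hX.irreducible hFΔ hev
  refine ⟨⟨hev, fun hsub => ?_, fun D _ E _ => ?_⟩, fun D _ E _ => key D E⟩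
  -- `F` is non-empty, and the image of any of its members already leaves the support.
  · obtain ⟨f, -⟩ := hF.irreducible.nonempty
    refine (hFΔ f.1 f.2).not_subset_support ?_
    rintro _ ⟨x, rfl⟩
    exact hsub ⟨(x, f), rfl⟩
  · simpa only [ComplexSpace.OrbifoldDivisor.trivial, mul_one] using key D E
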